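/- Let $(M,g)$ be a hyperbolic $3$-manifold, i.e. a smooth Riemannian $3$-manifold all of whose sectional curvatures are equal to $-1$, and let $f\colon S\to M$ be a smooth immersed minimal surface, i.e. $S$ is a smooth $2$-manifold and $f$ is a smooth immersion whose mean curvature vector (the trace of the second fundamental form) vanishes identically. Give $S$ the induced metric $f^*g$, and let $K_S$ be its Gauss curvature, $\Delta$ its Laplace operator (the trace of the Hessian), $A$ the second fundamental form of $f$ and $\|A\|^2$ its squared norm. Then at every point of $S$ at which $\|A\|\neq 0$ the function $\log\|A\|^2$ is smooth and $$\Delta\log(\|A\|^2)=4K_S=-2\,(2+\|A\|^2).$$ -/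

import Mathlib

open scoped Manifold ContDiff

noncomputable section

/-! ### Riemannian geometry on open pieces of `ℝⁿ`

A metric in coordinates is a function `G` that assigns to each point a bilinear form on `ℝⁿ`. -/

namespace LocalGeometry

/-- Coordinate space `ℝⁿ`. -/
abbrev E (n : ℕ) : Type := EuclideanSpace ℝ (Fin n)

/-- The `i`-th standard basis vector `∂ᵢ` of `ℝⁿ`. -/
def stdVec {n : ℕ} (i : Fin n) : E n := EuclideanSpace.single i 1

/-- The inverse `(bⁱʲ)` of the matrix `bᵢⱼ = b(∂ᵢ, ∂ⱼ)` of a bilinear form. -/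
def gramInv {n : ℕ} (b : E n →L[ℝ] E n →L[ℝ] ℝ) : Matrix (Fin n) (Fin n) ℝ :=
  (Matrix.of fun i j => b (stdVec i) (stdVec j))⁻¹

variable {m n : ℕ}

/-- The Christoffel symbols of the Levi-Civita connection, as a bilinear map:
`Γ(u, v) = ∑ₖₗ ½ Gᵏˡ (∂ᵤ G(v, ∂ₗ) + ∂ᵥ G(u, ∂ₗ) - ∂ₗ G(u, v)) ∂ₖ`. -/
def christoffel (G : E n → E n →L[ℝ] E n →L[ℝ] ℝ) (x u v : E n) : E n :=
  ∑ k, ∑ l, (gramInv (G x) k l * (1 / 2 : ℝ) *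
    (fderiv ℝ G x u v (stdVec l) + fderiv ℝ G x v u (stdVec l)
      - fderiv ℝ G x (stdVec l) u v)) • stdVec k

/-- The Riemann curvature `R(u, v)w = ∇ᵤ∇ᵥw - ∇ᵥ∇ᵤw` (for constant coordinate fields, whose
Lie brackets vanish). -/
def curvature (G : E n → E n →L[ℝ] E n →L[ℝ] ℝ) (x u v w : E n) : E n :=
  fderiv ℝ (fun y => christoffel G y v w) x u - fderiv ℝ (fun y => christoffel G y u w) x v
    + christoffel G x u (christoffel G x v w) - christoffel G x v (christoffel G x u w)

/-- The sectional curvature of the plane spanned by `u` and `v`: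
`⟨R(u, v)v, u⟩ / (|u|²|v|² - ⟨u, v⟩²)`. -/
def sectional (G : E n → E n →L[ℝ] E n →L[ℝ] ℝ) (x u v : E n) : ℝ :=
  G x (curvature G x u v v) u / (G x u u * G x v v - G x u v ^ 2)

/-- The Laplace operator, the trace of the Hessian:
`Δ φ = ∑ᵢⱼ Gⁱʲ (∂ᵢ∂ⱼ φ - dφ(Γ(∂ᵢ, ∂ⱼ)))`. -/
def laplace (G : E n → E n →L[ℝ] E n →L[ℝ] ℝ) (φ : E n → ℝ) (x : E n) : ℝ :=
  ∑ i, ∑ j, gramInv (G x) i j *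
    (fderiv ℝ (fderiv ℝ φ) x (stdVec i) (stdVec j)
      - fderiv ℝ φ x (christoffel G x (stdVec i) (stdVec j)))

/-- The orthogonal projection of `w` to the normal space, with respect to `G (F x)`, of the
parametrized submanifold `F` at `F x`: one subtracts from `w` its tangential part
`∑ᵢⱼ hⁱʲ ⟨w, ∂ᵢF⟩ ∂ⱼF`, where `hᵢⱼ = ⟨∂ᵢF, ∂ⱼF⟩` is the first fundamental form. -/
def normalPart (G : E n → E n →L[ℝ] E n →L[ℝ] ℝ) (F : E m → E n) (x : E m) (w : E n) : E n :=
  w - ∑ i, ∑ j,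
    (gramInv ((G (F x)).bilinearComp (fderiv ℝ F x) (fderiv ℝ F x)) i j *
      G (F x) w (fderiv ℝ F x (stdVec i))) • fderiv ℝ F x (stdVec j)

/-- The second fundamental form of a parametrized submanifold `F`: the normal part
of the ambient covariant derivative `∇ᵤ(dF(v)) = D²F(u, v) + Γ(dF(u), dF(v))`. -/
def secondForm (G : E n → E n →L[ℝ] E n →L[ℝ] ℝ) (F : E m → E n) (x u v : E m) : E n :=
  normalPart G F x
    (fderiv ℝ (fderiv ℝ F) x u v + christoffel G (F x) (fderiv ℝ F x u) (fderiv ℝ F x v))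

end LocalGeometry

/-! ### Riemannian geometry on manifolds -/

namespace ManifoldGeometry

open LocalGeometry

variable {m n : ℕ} {M S : Type*}
  [TopologicalSpace M] [ChartedSpace (EuclideanSpace ℝ (Fin n)) M]
  [TopologicalSpace S] [ChartedSpace (EuclideanSpace ℝ (Fin m)) S]

/-- A field of bilinear forms on the tangent spaces, read in the chart `e`. -/
def inChart (g : ∀ p : M, TangentSpace (𝓡 n) p →L[ℝ] TangentSpace (𝓡 n) p →L[ℝ] ℝ)
    (e : OpenPartialHomeomorph M (EuclideanSpace ℝ (Fin n))) (y : E n) :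
    E n →L[ℝ] E n →L[ℝ] ℝ :=
  (ContinuousLinearMap.precomp ℝ (mfderiv (𝓡 n) (𝓡 n) e.symm y)) ∘L
    (g (e.symm y)) ∘L (mfderiv (𝓡 n) (𝓡 n) e.symm y)

/-- All sectional curvatures of `g`, computed in arbitrary smooth local coordinates,
are equal to `κ`. -/
def HasConstantSectionalCurvature
    (g : ∀ p : M, TangentSpace (𝓡 n) p →L[ℝ] TangentSpace (𝓡 n) p →L[ℝ] ℝ) (κ : ℝ) : Prop :=
  ∀ e ∈ IsManifold.maximalAtlas (𝓡 n) ∞ M, ∀ y ∈ e.target, ∀ u v : E n,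
    LinearIndependent ℝ ![u, v] → sectional (inChart g e) y u v = κ

/-- The Gauss curvature of a surface with metric `h` at `p`: the sectional curvature of its
tangent plane. -/
def gaussCurvature {S : Type*} [TopologicalSpace S] [ChartedSpace (EuclideanSpace ℝ (Fin 2)) S]
    (h : ∀ p : S, TangentSpace (𝓡 2) p →L[ℝ] TangentSpace (𝓡 2) p →L[ℝ] ℝ) (p : S) : ℝ :=
  sectional (inChart h (chartAt (EuclideanSpace ℝ (Fin 2)) p))
    (chartAt (EuclideanSpace ℝ (Fin 2)) p p) (stdVec 0) (stdVec 1)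

/-- The Laplace operator of the metric `h`, applied to the function `φ`, at `p`. -/
def laplacian (h : ∀ p : S, TangentSpace (𝓡 m) p →L[ℝ] TangentSpace (𝓡 m) p →L[ℝ] ℝ)
    (φ : S → ℝ) (p : S) : ℝ :=
  laplace (inChart h (chartAt (EuclideanSpace ℝ (Fin m)) p))
    (φ ∘ (chartAt (EuclideanSpace ℝ (Fin m)) p).symm) (chartAt (EuclideanSpace ℝ (Fin m)) p p)

/-- The metric induced by the immersion `f` (the first fundamental form). -/
def inducedMetric (g : ∀ p : M, TangentSpace (𝓡 n) p →L[ℝ] TangentSpace (𝓡 n) p →L[ℝ] ℝ)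
    (f : S → M) (p : S) : TangentSpace (𝓡 m) p →L[ℝ] TangentSpace (𝓡 m) p →L[ℝ] ℝ :=
  (ContinuousLinearMap.precomp ℝ (mfderiv (𝓡 m) (𝓡 n) f p)) ∘L
    (g (f p)) ∘L (mfderiv (𝓡 m) (𝓡 n) f p)

/-- The second fundamental form `A` of the immersion `f`, with values in the normal space
(no choice of a unit normal is involved). It is computed in the preferred charts at `p` and
`f p`, through which `TangentSpace` identifies the tangent spaces with coordinate spaces. -/
def secondFundamentalForm
    (g : ∀ p : M, TangentSpace (𝓡 n) p →L[ℝ] TangentSpace (𝓡 n) p →L[ℝ] ℝ)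
    (f : S → M) (p : S) (u v : TangentSpace (𝓡 m) p) : TangentSpace (𝓡 n) (f p) :=
  secondForm (inChart g (chartAt (EuclideanSpace ℝ (Fin n)) (f p)))
    (chartAt (EuclideanSpace ℝ (Fin n)) (f p) ∘ f ∘ (chartAt (EuclideanSpace ℝ (Fin m)) p).symm)
    (chartAt (EuclideanSpace ℝ (Fin m)) p p) u v

/-- The mean curvature vector, the trace `∑ᵢⱼ hⁱʲ A(∂ᵢ, ∂ⱼ)` of the second fundamental form with
respect to the induced metric `h`. -/
def meanCurvatureVector
    (g : ∀ p : M, TangentSpace (𝓡 n) p →L[ℝ] TangentSpace (𝓡 n) p →L[ℝ] ℝ)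
    (f : S → M) (p : S) : TangentSpace (𝓡 n) (f p) :=
  ∑ i : Fin m, ∑ j : Fin m, gramInv (inducedMetric g f p) i j •
    secondFundamentalForm g f p (stdVec i) (stdVec j)

/-- The squared norm `‖A‖² = ∑ hⁱᵏ hʲˡ ⟨A(∂ᵢ, ∂ⱼ), A(∂ₖ, ∂ₗ)⟩` of the second fundamental form. -/
def secondFundamentalFormNormSq
    (g : ∀ p : M, TangentSpace (𝓡 n) p →L[ℝ] TangentSpace (𝓡 n) p →L[ℝ] ℝ)
    (f : S → M) (p : S) : ℝ :=
  ∑ i : Fin m, ∑ j : Fin m, ∑ k : Fin m, ∑ l : Fin m,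
    gramInv (inducedMetric g f p) i k * gramInv (inducedMetric g f p) j l *
      g (f p) (secondFundamentalForm g f p (stdVec i) (stdVec j))
        (secondFundamentalForm g f p (stdVec k) (stdVec l))

/-- `f` is a smooth immersion of `S` into the Riemannian manifold `(M, g)` that is minimal:
its mean curvature vanishes identically. -/
structure IsMinimalImmersion
    (g : ∀ p : M, TangentSpace (𝓡 n) p →L[ℝ] TangentSpace (𝓡 n) p →L[ℝ] ℝ)
    (f : S → M) : Prop where
  smooth : ContMDiff (𝓡 m) (𝓡 n) ∞ f
  immersion : ∀ p, Function.Injective (mfderiv (𝓡 m) (𝓡 n) f p)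
  minimal : ∀ p, meanCurvatureVector (m := m) g f p = 0

end ManifoldGeometry

end

/-! Read in charts, $f$ is a parametrized surface $F$ in a coordinate domain with a metric $G$ of
constant curvature $-1$. Near a point there is a smooth unit normal $N$ (`exists_isUnitNormal`), and
$A = a\,N$ for a scalar symmetric form $a$, which is trace-free by minimality.

Two consequences of constant curvature are used. The tangential part of the curvature of $G$ along
$F$ gives the Gauss equation $K_S = -1 + \det a/\det h$; for a trace-free form in two dimensions
$\|a\|^2 = -2\det a/\det h$, so $K_S = -1 - \|A\|^2/2$, which is the second equality. The vector
$R(u,v)v$ is tangent to the surface (`curvature_normal`), so the normal part gives the Codazzi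
equation (`IsUnitNormal.codazzi`): $\nabla a$ is totally symmetric.

The first equality holds for every trace-free Codazzi tensor on a surface, wherever it does not
vanish (`laplace_log_codazzi`). Conceptually, in isothermal coordinates with $h=\lambda|dz|^2$, such
a tensor is the real part of a holomorphic quadratic differential $\varphi\,dz^2$, so $\log\|a\|^2 =
\log|\varphi|^2 - 2\log\lambda + \text{const}$; the first term is harmonic and
$\Delta\log\lambda=-2K_S$. Isothermal coordinates are avoided here: in a constant frame, orthonormal
only at the point considered, the first and second derivatives of metric compatibility, of the trace
condition and of the Codazzi equation turn the claim into a polynomial identity between jets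
(`simons_jet`).

Finally, $A$ at each point is defined through the preferred charts at that very point, whereas
differentiation needs one fixed chart. `chart_independence` shows that $\|A\|^2$ and the vanishing
of the mean curvature do not depend on the charts. -/

noncomputable section

namespace LocalGeometry

/-! ### Linear algebra of bilinear forms on `ℝⁿ` -/

variable {m n : ℕ}

/-- Positive definite symmetric bilinear forms. -/
structure IsInner (b : E n →L[ℝ] E n →L[ℝ] ℝ) : Prop where
  symm : ∀ v w, b v w = b w v
  pos : ∀ v, v ≠ 0 → 0 < b v v

theorem sum_smul_stdVec (v : E n) : ∑ i, v i • stdVec i = v := by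
  ext j
  simp [stdVec, Pi.single_apply]

theorem stdVec_apply (i j : Fin n) : (stdVec i : E n) j = if j = i then 1 else 0 := by
  simp [stdVec]

theorem IsInner.eq_zero {b : E n →L[ℝ] E n →L[ℝ] ℝ} (hb : IsInner b) {v : E n}
    (h : ∀ w, b v w = 0) : v = 0 := by
  by_contra hv
  exact (hb.pos v hv).ne' (h v)

/-- The Gram matrix of a bilinear form in the family `w`. -/
def gram (b : E n →L[ℝ] E n →L[ℝ] ℝ) (w : Fin m → E n) : Matrix (Fin m) (Fin m) ℝ :=
  Matrix.of fun i j => b (w i) (w j)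

theorem gramInv_eq (b : E n →L[ℝ] E n →L[ℝ] ℝ) : gramInv b = (gram b stdVec)⁻¹ := rfl

/-- A vector in the kernel of the Gram matrix would be `b`-orthogonal to everything, itself
included. -/
theorem IsInner.det_gram_ne_zero {b : E n →L[ℝ] E n →L[ℝ] ℝ} (hb : IsInner b) :
    (gram b stdVec).det ≠ 0 := by
  intro h
  obtain ⟨v, hv, hv0⟩ := Matrix.exists_mulVec_eq_zero_iff.2 h
  apply hv
  have key : (∑ i, v i • stdVec i : E n) = 0 := by
    apply hb.eq_zero
    intro w
    rw [hb.symm, ← sum_smul_stdVec w]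
    simp only [map_sum, map_smul, sum_apply, smul_apply, smul_eq_mul]
    simp_rw [Finset.mul_sum]
    rw [Finset.sum_comm]
    refine Finset.sum_eq_zero fun i _ => ?_
    have := congrFun hv0 i
    simp only [Matrix.mulVec, dotProduct, gram, Matrix.of_apply, Pi.zero_apply] at this
    rw [← mul_zero (w i), ← this, Finset.mul_sum]
    exact Finset.sum_congr rfl fun k _ => by ring
  ext j
  have := congrArg (fun z : E n => z j) key
  simpa [stdVec_apply] using this

theorem IsInner.gramInv_mul_gram {b : E n →L[ℝ] E n →L[ℝ] ℝ} (hb : IsInner b) (i j : Fin n) :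
    ∑ k, gramInv b i k * b (stdVec k) (stdVec j) = if i = j then 1 else 0 := by
  have := Matrix.nonsing_inv_mul (gram b stdVec) (isUnit_iff_ne_zero.2 hb.det_gram_ne_zero)
  have := congrFun (congrFun this i) j
  rwa [Matrix.mul_apply, Matrix.one_apply] at this

theorem IsInner.gramInv_symm {b : E n →L[ℝ] E n →L[ℝ] ℝ} (hb : IsInner b) (i j : Fin n) :
    gramInv b i j = gramInv b j i := by
  have h : (gram b stdVec).transpose = gram b stdVec := by
    ext i j; exact hb.symm _ _
  have : (gramInv b).transpose = gramInv b := by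
    rw [gramInv_eq, Matrix.transpose_nonsing_inv, h]
  exact (congrFun (congrFun this j) i)

/-- The vector that represents the functional `c` with respect to `b`. -/
def riesz (b : E n →L[ℝ] E n →L[ℝ] ℝ) (c : E n → ℝ) : E n :=
  ∑ k, ∑ l, (gramInv b k l * c (stdVec l)) • stdVec k

theorem IsInner.apply_riesz {b : E n →L[ℝ] E n →L[ℝ] ℝ} (hb : IsInner b) (c : E n →ₗ[ℝ] ℝ)
    (w : E n) : b (riesz b c) w = c w := by
  conv_rhs => rw [← sum_smul_stdVec w]
  conv_lhs => rw [← sum_smul_stdVec w]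
  simp only [map_sum, map_smul, smul_eq_mul]
  refine Finset.sum_congr rfl fun j _ => ?_
  congr 1
  simp only [riesz, map_sum, map_smul, sum_apply,
    smul_apply, smul_eq_mul]
  rw [Finset.sum_comm]
  have : ∀ l, ∑ k, gramInv b k l * c (stdVec l) * b (stdVec k) (stdVec j)
      = c (stdVec l) * (if l = j then 1 else 0) := by
    intro l
    rw [← hb.gramInv_mul_gram l j, Finset.mul_sum]
    refine Finset.sum_congr rfl fun k _ => ?_
    rw [hb.gramInv_symm k l]; ring
  simp [this]

theorem IsInner.ext {b : E n →L[ℝ] E n →L[ℝ] ℝ} (hb : IsInner b) {v v' : E n}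
    (h : ∀ w, b v w = b v' w) : v = v' := by
  rw [← sub_eq_zero]
  exact hb.eq_zero fun w => by simp [h w]

theorem gram_comp (b : E n →L[ℝ] E n →L[ℝ] ℝ) (w : Fin n → E n)
    (P : Matrix (Fin n) (Fin n) ℝ) (hP : ∀ i, w i = ∑ j, P i j • stdVec j) :
    gram b w = P * gram b stdVec * P.transpose := by
  ext i j
  simp only [gram, Matrix.mul_apply, Matrix.of_apply, Matrix.transpose_apply, hP, map_sum, map_smul,
    sum_apply, smul_apply, smul_eq_mul, Finset.sum_mul,
    Finset.mul_sum]
  refine Finset.sum_congr rfl fun k _ => Finset.sum_congr rfl fun l _ => by ring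

theorem sum_comm₄ {V : Type*} [AddCommMonoid V] (f : Fin n → Fin n → Fin n → Fin n → V) :
    ∑ i, ∑ j, ∑ k, ∑ l, f i j k l = ∑ k, ∑ l, ∑ j, ∑ i, f i j k l := by
  calc _ = ∑ i, ∑ k, ∑ j, ∑ l, f i j k l := Finset.sum_congr rfl fun i _ => Finset.sum_comm
    _ = ∑ k, ∑ i, ∑ j, ∑ l, f i j k l := Finset.sum_comm
    _ = ∑ k, ∑ i, ∑ l, ∑ j, f i j k l :=
      Finset.sum_congr rfl fun _ _ => Finset.sum_congr rfl fun _ _ => Finset.sum_comm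
    _ = ∑ k, ∑ l, ∑ i, ∑ j, f i j k l := Finset.sum_congr rfl fun _ _ => Finset.sum_comm
    _ = _ := Finset.sum_congr rfl fun _ _ => Finset.sum_congr rfl fun _ _ => Finset.sum_comm

/-- The trace of a bilinear map with respect to an inner product may be computed in any basis. -/
theorem sum_gram_inv_smul {V : Type*} [AddCommGroup V] [Module ℝ V]
    (b : E n →L[ℝ] E n →L[ℝ] ℝ) (w : Fin n → E n) (hw : LinearIndependent ℝ w)
    (B : E n →ₗ[ℝ] E n →ₗ[ℝ] V) :
    ∑ i, ∑ j, (gram b w)⁻¹ i j • B (w i) (w j)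
      = ∑ i, ∑ j, gramInv b i j • B (stdVec i) (stdVec j) := by
  let P : Matrix (Fin n) (Fin n) ℝ := Matrix.of fun i j => w i j
  have hP : ∀ i, w i = ∑ j, P i j • stdVec j := fun i => (sum_smul_stdVec (w i)).symm
  have hPu : IsUnit P := by
    rw [← Matrix.linearIndependent_rows_iff_isUnit]
    have := hw.map' (WithLp.linearEquiv 2 ℝ (Fin n → ℝ)).toLinearMap (LinearEquiv.ker _)
    exact this
  have hPd : IsUnit P.det := (Matrix.isUnit_iff_isUnit_det _).1 hPu
  -- By `gram_comp` the Gram matrix of `w` is $P g P^T$, so its inverse is $P^{-T} g^{-1} P^{-1}$,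
  -- and the outer factors cancel the change of basis in the arguments of `B`.
  have hmat : P.transpose * (gram b w)⁻¹ * P = gramInv b := by
    rw [gram_comp b w P hP, Matrix.mul_inv_rev, Matrix.mul_inv_rev, gramInv_eq,
      ← Matrix.transpose_nonsing_inv]
    have h1 : P.transpose * P⁻¹.transpose = 1 := by
      rw [← Matrix.transpose_mul, Matrix.nonsing_inv_mul _ hPd, Matrix.transpose_one]
    rw [← mul_assoc, h1, one_mul, mul_assoc, Matrix.nonsing_inv_mul _ hPd, mul_one]
  rw [← hmat]
  simp only [hP, map_sum, map_smul, LinearMap.sum_apply, LinearMap.smul_apply, Finset.smul_sum,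
    Matrix.mul_apply, Matrix.transpose_apply, Finset.sum_smul, smul_smul, Finset.sum_mul]
  rw [sum_comm₄, Finset.sum_comm]
  refine Finset.sum_congr rfl fun k _ => Finset.sum_congr rfl fun l _ =>
    Finset.sum_congr rfl fun j _ => Finset.sum_congr rfl fun i _ => ?_
  congr 1
  ring

end LocalGeometry

namespace LocalGeometry

/-! ### Covariant derivatives along a map -/

variable {m n : ℕ}

section smoothness

variable {D F' : Type*} [NormedAddCommGroup D] [NormedSpace ℝ D]
  [NormedAddCommGroup F'] [NormedSpace ℝ F']

/-- The source `E n` is finite-dimensional, so smoothness of an operator-valued map may be tested on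
vectors; applied twice, it reduces tensors to their scalar components. -/
theorem contDiffAt_clm_apply {k : ℕ∞ω} {f : D → E n →L[ℝ] F'} {x : D}
    (h : ∀ y, ContDiffAt ℝ k (fun z => f z y) x) : ContDiffAt ℝ k f x := by
  let d := Module.finrank ℝ (E n)
  have hd : d = Module.finrank ℝ (Fin d → ℝ) := (Module.finrank_fin_fun ℝ).symm
  let e₁ := ContinuousLinearEquiv.ofFinrankEq hd
  let e₂ := (e₁.arrowCongr (1 : F' ≃L[ℝ] F')).trans (ContinuousLinearEquiv.piRing (Fin d))
  rw [← Function.id_comp f, ← e₂.symm_comp_self]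
  exact e₂.symm.contDiff.contDiffAt.comp x (contDiffAt_pi.mpr fun i => h _)

theorem contDiffAt_det {k : ℕ∞ω} {A : D → Matrix (Fin n) (Fin n) ℝ} {x : D}
    (h : ∀ i j, ContDiffAt ℝ k (fun y => A y i j) x) : ContDiffAt ℝ k (fun y => (A y).det) x := by
  simp only [Matrix.det_apply]
  exact ContDiffAt.sum fun σ _ => (contDiffAt_prod fun i _ => h _ _).const_smul _

theorem contDiffAt_gramInv {k : ℕ∞ω} {b : D → E n →L[ℝ] E n →L[ℝ] ℝ} {x : D}
    (hb : ContDiffAt ℝ k b x) (hi : IsInner (b x)) (i j : Fin n) :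
    ContDiffAt ℝ k (fun y => gramInv (b y) i j) x := by
  have hentry : ∀ i j, ContDiffAt ℝ k (fun y => gram (b y) stdVec i j) x := fun i j =>
    (hb.clm_apply contDiffAt_const).clm_apply contDiffAt_const
  have hadj : ContDiffAt ℝ k (fun y => (gram (b y) stdVec).adjugate i j) x := by
    simp only [Matrix.adjugate_apply]
    refine contDiffAt_det fun i' j' => ?_
    simp only [Matrix.updateRow_apply]
    split_ifs
    · exact contDiffAt_const
    · exact hentry _ _
  have := ((contDiffAt_det hentry).inv hi.det_gram_ne_zero).mul hadj
  refine this.congr_of_eventuallyEq (Filter.Eventually.of_forall fun y => ?_)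
  simp [gramInv_eq, Matrix.inv_def, Ring.inverse_eq_inv']

theorem contDiffAt_riesz {k : ℕ∞ω} {b : D → E n →L[ℝ] E n →L[ℝ] ℝ} {x : D}
    (hb : ContDiffAt ℝ k b x) (hi : IsInner (b x)) {c : D → E n → ℝ}
    (hc : ∀ w, ContDiffAt ℝ k (fun y => c y w) x) :
    ContDiffAt ℝ k (fun y => riesz (b y) (c y)) x := by
  unfold riesz
  exact ContDiffAt.sum fun i _ => ContDiffAt.sum fun j _ =>
    ((contDiffAt_gramInv hb hi i j).mul (hc _)).smul contDiffAt_const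

end smoothness

theorem fderiv_symm_of_contDiffAt {F' : Type*} [NormedAddCommGroup F'] [NormedSpace ℝ F']
    {f : E m → F'} {x : E m}
    (hf : ContDiffAt ℝ ∞ f x) (u v : E m) :
    fderiv ℝ (fderiv ℝ f) x u v = fderiv ℝ (fderiv ℝ f) x v u :=
  (hf.isSymmSndFDerivAt (by simpa using ENat.LEInfty.out)).eq u v

theorem _root_.ContDiffAt.fderiv_infty {F' : Type*} [NormedAddCommGroup F'] [NormedSpace ℝ F']
    {f : E m → F'} {x : E m} (hf : ContDiffAt ℝ ∞ f x) : ContDiffAt ℝ ∞ (fderiv ℝ f) x :=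
  hf.fderiv_right (m := ∞) (by simp)

theorem fderiv_apply_const {F' F'' : Type*} [NormedAddCommGroup F'] [NormedSpace ℝ F']
    [NormedAddCommGroup F''] [NormedSpace ℝ F'']
    {c : E m → F' →L[ℝ] F''} {x : E m} (hc : DifferentiableAt ℝ c x) (v : F') (u : E m) :
    fderiv ℝ (fun y => c y v) x u = fderiv ℝ c x u v := by
  rw [fderiv_clm_apply hc (differentiableAt_const v)]
  simp

/-- `G` is a smooth Riemannian metric on the open set `U`. -/
structure IsMetricOn (G : E n → E n →L[ℝ] E n →L[ℝ] ℝ) (U : Set (E n)) : Prop where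
  isOpen : IsOpen U
  smooth : ∀ y ∈ U, ContDiffAt ℝ ∞ G y
  inner : ∀ y ∈ U, IsInner (G y)

variable {G : E n → E n →L[ℝ] E n →L[ℝ] ℝ} {U : Set (E n)}

/-- The Christoffel vector represents the Koszul functional. Bilinearity, smoothness and the Koszul
formula all follow from this description. -/
theorem christoffel_eq_riesz (G : E n → E n →L[ℝ] E n →L[ℝ] ℝ) (x u v : E n) :
    christoffel G x u v = riesz (G x) (fun w => (1 / 2 : ℝ) * (fderiv ℝ G x u v w
      + fderiv ℝ G x v u w - fderiv ℝ G x w u v)) := by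
  simp only [christoffel, riesz, mul_assoc]

theorem riesz_add (b : E n →L[ℝ] E n →L[ℝ] ℝ) (c c' : E n → ℝ) :
    riesz b (fun w => c w + c' w) = riesz b c + riesz b c' := by
  simp only [riesz, mul_add, add_smul, Finset.sum_add_distrib]

theorem riesz_smul (b : E n →L[ℝ] E n →L[ℝ] ℝ) (r : ℝ) (c : E n → ℝ) :
    riesz b (fun w => r * c w) = r • riesz b c := by
  simp only [riesz, mul_left_comm _ r, mul_smul, Finset.smul_sum]

/-- The Christoffel symbols as a continuous bilinear map. -/
def chr (G : E n → E n →L[ℝ] E n →L[ℝ] ℝ) (x : E n) : E n →L[ℝ] E n →L[ℝ] E n :=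
  LinearMap.toContinuousLinearMap
    { toFun u := LinearMap.toContinuousLinearMap
        { toFun v := christoffel G x u v
          map_add' v v' := by
            simp only [christoffel_eq_riesz]
            rw [← riesz_add]; congr 1; ext w; simp; ring
          map_smul' r v := by
            simp only [christoffel_eq_riesz]
            rw [RingHom.id_apply, ← riesz_smul]; congr 1; ext w; simp; ring }
      map_add' u u' := by
        ext1 v
        simp only [LinearMap.coe_toContinuousLinearMap', LinearMap.coe_mk, AddHom.coe_mk, add_apply]
        simp only [christoffel_eq_riesz]
        rw [← riesz_add]; congr 1; ext w; simp; ring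
      map_smul' r u := by
        ext1 v
        simp only [LinearMap.coe_toContinuousLinearMap', LinearMap.coe_mk, AddHom.coe_mk,
          smul_apply, RingHom.id_apply]
        simp only [christoffel_eq_riesz]
        rw [← riesz_smul]; congr 1; ext w; simp; ring }

theorem chr_apply (G : E n → E n →L[ℝ] E n →L[ℝ] ℝ) (x u v : E n) :
    chr G x u v = christoffel G x u v := rfl

theorem contDiffAt_chr {x : E n} (hG : ContDiffAt ℝ ∞ G x) (hi : IsInner (G x)) :
    ContDiffAt ℝ ∞ (chr G) x := by
  refine contDiffAt_clm_apply fun u => contDiffAt_clm_apply fun v => ?_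
  simp only [chr_apply, christoffel_eq_riesz]
  refine contDiffAt_riesz hG hi fun w => contDiffAt_const.mul ?_
  have h : ∀ a b c : E n, ContDiffAt ℝ ∞ (fun y => fderiv ℝ G y a b c) x := fun a b c =>
    ((hG.fderiv_infty.clm_apply contDiffAt_const).clm_apply contDiffAt_const).clm_apply
      contDiffAt_const
  exact ((h _ _ _).add (h _ _ _)).sub (h _ _ _)

namespace IsMetricOn

variable (H : IsMetricOn G U)
include H

theorem mem_nhds {y : E n} (hy : y ∈ U) : U ∈ nhds y := H.isOpen.mem_nhds hy

theorem fderiv_metric_symm {y : E n} (hy : y ∈ U) (u v w : E n) :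
    fderiv ℝ G y u v w = fderiv ℝ G y u w v := by
  have hd := (H.smooth y hy).differentiableAt (by simp)
  have h : ∀ v w, fderiv ℝ (fun z => G z v w) y u = fderiv ℝ G y u v w := fun v w => by
    rw [fderiv_apply_const (hd.clm_apply (differentiableAt_const v)), fderiv_apply_const hd]
  rw [← h, ← h]
  have : (fun z => G z v w) =ᶠ[nhds y] fun z => G z w v := by
    filter_upwards [H.mem_nhds hy] with z hz using (H.inner z hz).symm v w
  rw [this.fderiv_eq]

theorem koszul {y : E n} (hy : y ∈ U) (u v w : E n) :
    G y (christoffel G y u v) w = (1 / 2 : ℝ) * (fderiv ℝ G y u v w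
      + fderiv ℝ G y v u w - fderiv ℝ G y w u v) := by
  rw [christoffel_eq_riesz]
  let c : E n →ₗ[ℝ] ℝ :=
    { toFun w := (1 / 2 : ℝ) * (fderiv ℝ G y u v w + fderiv ℝ G y v u w - fderiv ℝ G y w u v)
      map_add' w w' := by simp; ring
      map_smul' r w := by simp; ring }
  exact (H.inner y hy).apply_riesz c w

theorem christoffel_symm {y : E n} (hy : y ∈ U) (u v : E n) :
    christoffel G y u v = christoffel G y v u := by
  refine (H.inner y hy).ext fun w => ?_
  rw [H.koszul hy, H.koszul hy, H.fderiv_metric_symm hy w u v]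
  ring

theorem fderiv_metric {y : E n} (hy : y ∈ U) (u v w : E n) :
    fderiv ℝ G y u v w = G y (christoffel G y u v) w + G y v (christoffel G y u w) := by
  rw [(H.inner y hy).symm v, H.koszul hy, H.koszul hy, H.fderiv_metric_symm hy u w v,
    H.fderiv_metric_symm hy w u v]
  ring

end IsMetricOn

/-- The covariant derivative in the direction `u` of a vector field `V` along `F`. -/
def cov (G : E n → E n →L[ℝ] E n →L[ℝ] ℝ) (F V : E m → E n) (x u : E m) : E n :=
  fderiv ℝ V x u + chr G (F x) (fderiv ℝ F x u) (V x)

theorem contDiffAt_cov {F V : E m → E n} {x : E m} (hG : ContDiffAt ℝ ∞ G (F x))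
    (hi : IsInner (G (F x))) (hF : ContDiffAt ℝ ∞ F x) (hV : ContDiffAt ℝ ∞ V x) (u : E m) :
    ContDiffAt ℝ ∞ (fun y => cov G F V y u) x := by
  have h := (contDiffAt_chr hG hi).comp x hF
  exact (hV.fderiv_infty.clm_apply contDiffAt_const).add
    ((h.clm_apply (hF.fderiv_infty.clm_apply contDiffAt_const)).clm_apply hV)

theorem cov_congr {F V W : E m → E n} {x : E m} (h : V =ᶠ[nhds x] W) (u : E m) :
    cov G F V x u = cov G F W x u := by
  rw [cov, cov, h.fderiv_eq, h.eq_of_nhds]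

theorem IsMetricOn.fderiv_inner (H : IsMetricOn G U) {F V W : E m → E n} {x : E m} (hx : F x ∈ U)
    (hF : DifferentiableAt ℝ F x) (hV : DifferentiableAt ℝ V x) (hW : DifferentiableAt ℝ W x)
    (u : E m) :
    fderiv ℝ (fun y => G (F y) (V y) (W y)) x u
      = G (F x) (cov G F V x u) (W x) + G (F x) (V x) (cov G F W x u) := by
  have hd := (H.smooth _ hx).differentiableAt (by simp)
  have h1 : DifferentiableAt ℝ (fun y => G (F y)) x := hd.comp x hF
  rw [fderiv_clm_apply (h1.clm_apply hV) hW, fderiv_clm_apply h1 hV]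
  have h2 : fderiv ℝ (fun y => G (F y)) x = (fderiv ℝ G (F x)).comp (fderiv ℝ F x) :=
    fderiv_comp x hd hF
  rw [h2]
  simp only [cov, add_apply, ContinuousLinearMap.coe_comp, Function.comp_apply,
    ContinuousLinearMap.flip_apply, map_add, H.fderiv_metric hx, chr_apply]
  ring

/-- The commutator of covariant derivatives along a map is the ambient curvature. There is no
bracket term since `u` and `v` are constant; the second derivatives of `V` and of `F` cancel by
symmetry. -/
theorem cov_cov_sub {F V : E m → E n} {x : E m} (hG : ContDiffAt ℝ ∞ G (F x))
    (hi : IsInner (G (F x))) (hF : ContDiffAt ℝ ∞ F x) (hV : ContDiffAt ℝ ∞ V x) (u v : E m) :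
    cov G F (fun y => cov G F V y v) x u - cov G F (fun y => cov G F V y u) x v
      = curvature G (F x) (fderiv ℝ F x u) (fderiv ℝ F x v) (V x) := by
  have hchr := (contDiffAt_chr hG hi).differentiableAt (by simp)
  have hFd := hF.differentiableAt (by simp)
  have hVd := hV.differentiableAt (by simp)
  have hF2 := hF.fderiv_infty.differentiableAt (by simp)
  have hV2 := hV.fderiv_infty.differentiableAt (by simp)
  have h1 : DifferentiableAt ℝ (fun y => chr G (F y)) x := hchr.comp x hFd
  have hc : fderiv ℝ (fun y => chr G (F y)) x = (fderiv ℝ (chr G) (F x)).comp (fderiv ℝ F x) :=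
    fderiv_comp x hchr hFd
  have key : ∀ u v, fderiv ℝ (fun y => cov G F V y v) x u
      = fderiv ℝ (fderiv ℝ V) x u v
        + (fderiv ℝ (chr G) (F x) (fderiv ℝ F x u) (fderiv ℝ F x v) (V x)
          + chr G (F x) (fderiv ℝ (fderiv ℝ F) x u v) (V x)
          + chr G (F x) (fderiv ℝ F x v) (fderiv ℝ V x u)) := by
    intro u v
    unfold cov
    have hF2v : DifferentiableAt ℝ (fun y => fderiv ℝ F y v) x :=
      hF2.clm_apply (differentiableAt_const v)
    have hV2v : DifferentiableAt ℝ (fun y => fderiv ℝ V y v) x :=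
      hV2.clm_apply (differentiableAt_const v)
    rw [fderiv_fun_add hV2v ((h1.clm_apply hF2v).clm_apply hVd),
      fderiv_clm_apply (h1.clm_apply hF2v) hVd, fderiv_clm_apply h1 hF2v, hc]
    simp only [add_apply, ContinuousLinearMap.coe_comp, Function.comp_apply,
      ContinuousLinearMap.flip_apply, fderiv_apply_const hF2, fderiv_apply_const hV2]
    abel
  have hcurv : ∀ a b c, fderiv ℝ (fun y => christoffel G y b c) (F x) a
      = fderiv ℝ (chr G) (F x) a b c := by
    intro a b c
    simp only [← chr_apply]
    rw [fderiv_apply_const (hchr.clm_apply (differentiableAt_const b)), fderiv_apply_const hchr]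
  have key' : ∀ u v, cov G F (fun y => cov G F V y v) x u = _ := fun u v =>
    congrArg (· + chr G (F x) (fderiv ℝ F x u) (cov G F V x v)) (key u v)
  rw [key', key', curvature, hcurv, hcurv, fderiv_symm_of_contDiffAt hF v u,
    fderiv_symm_of_contDiffAt hV v u]
  simp only [cov, map_add, ← chr_apply]
  abel

end LocalGeometry

namespace LocalGeometry

/-! ### Parametrized submanifolds: the equations of Gauss and Codazzi -/

variable {m n : ℕ} {G : E n → E n →L[ℝ] E n →L[ℝ] ℝ} {U : Set (E n)}
  {F : E m → E n} {V : Set (E m)}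

/-- `F` is a smooth immersion of the open set `V` into `U`. -/
structure IsImmersionOn (F : E m → E n) (V : Set (E m)) (U : Set (E n)) : Prop where
  isOpen : IsOpen V
  smooth : ∀ y ∈ V, ContDiffAt ℝ ∞ F y
  mapsTo : Set.MapsTo F V U
  injective : ∀ y ∈ V, Function.Injective (fderiv ℝ F y)

/-- The first fundamental form of `F`. -/
def pullback (G : E n → E n →L[ℝ] E n →L[ℝ] ℝ) (F : E m → E n) (x : E m) :
    E m →L[ℝ] E m →L[ℝ] ℝ :=
  (G (F x)).bilinearComp (fderiv ℝ F x) (fderiv ℝ F x)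

theorem pullback_apply (G : E n → E n →L[ℝ] E n →L[ℝ] ℝ) (F : E m → E n) (x u v : E m) :
    pullback G F x u v = G (F x) (fderiv ℝ F x u) (fderiv ℝ F x v) := rfl

theorem IsMetricOn.pullback (H : IsMetricOn G U) (I : IsImmersionOn F V U) :
    IsMetricOn (pullback G F) V where
  isOpen := I.isOpen
  smooth y hy := by
    have hF := (I.smooth y hy).fderiv_infty
    refine contDiffAt_clm_apply fun u => contDiffAt_clm_apply fun v => ?_
    simp only [pullback_apply]
    exact ((((H.smooth _ (I.mapsTo hy)).comp y (I.smooth y hy)).clm_apply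
      (hF.clm_apply contDiffAt_const)).clm_apply (hF.clm_apply contDiffAt_const))
  inner y hy :=
    { symm := fun v w => (H.inner _ (I.mapsTo hy)).symm _ _
      pos := fun v hv => (H.inner _ (I.mapsTo hy)).pos _
        fun h => hv (I.injective y hy (by simpa using h)) }

/-- The tangential part of a vector, as a vector in the parameter space. -/
def tangentPart (G : E n → E n →L[ℝ] E n →L[ℝ] ℝ) (F : E m → E n) (x : E m) (w : E n) : E m :=
  riesz (LocalGeometry.pullback G F x) (fun z => G (F x) w (fderiv ℝ F x z))

namespace IsMetricOn

variable (H : IsMetricOn G U) (I : IsImmersionOn F V U)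
include H I

theorem normalPart_eq {x : E m} (hx : x ∈ V) (w : E n) :
    normalPart G F x w = w - fderiv ℝ F x (tangentPart G F x w) := by
  simp only [normalPart, tangentPart, riesz, map_sum, map_smul]
  rw [Finset.sum_comm]
  congr 1
  refine Finset.sum_congr rfl fun i _ => Finset.sum_congr rfl fun j _ => ?_
  rw [((H.pullback I).inner x hx).gramInv_symm i j]
  rfl

theorem pullback_tangentPart {x : E m} (hx : x ∈ V) (w : E n) (z : E m) :
    LocalGeometry.pullback G F x (tangentPart G F x w) z = G (F x) w (fderiv ℝ F x z) :=
  ((H.pullback I).inner x hx).apply_riesz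
    ((G (F x) w).comp (fderiv ℝ F x) : E m →ₗ[ℝ] ℝ) z

theorem normalPart_orth {x : E m} (hx : x ∈ V) (w : E n) (z : E m) :
    G (F x) (normalPart G F x w) (fderiv ℝ F x z) = 0 := by
  rw [H.normalPart_eq I hx, map_sub, sub_apply, ← H.pullback_tangentPart I hx, pullback_apply,
    sub_self]

theorem tangentPart_eq {x : E m} (hx : x ∈ V) {w : E n} {r : E m}
    (h : ∀ z, G (F x) w (fderiv ℝ F x z) = LocalGeometry.pullback G F x r z) :
    tangentPart G F x w = r :=
  ((H.pullback I).inner x hx).ext fun z => by rw [H.pullback_tangentPart I hx, h]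

/-- The formula of Gauss: the tangential part of the ambient covariant derivative is the
covariant derivative of the induced metric. -/
theorem cov_fderiv {x : E m} (hx : x ∈ V) (u v : E m) :
    cov G F (fun y => fderiv ℝ F y v) x u
      = fderiv ℝ F x (christoffel (LocalGeometry.pullback G F) x u v)
        + secondForm G F x u v := by
  have hF := I.smooth x hx
  have hF2 := hF.fderiv_infty.differentiableAt (by simp)
  have hP := H.pullback I
  have hc : ∀ u v, cov G F (fun y => fderiv ℝ F y v) x u = fderiv ℝ (fderiv ℝ F) x u v
      + christoffel G (F x) (fderiv ℝ F x u) (fderiv ℝ F x v) := fun u v => by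
    rw [cov, fderiv_apply_const hF2, chr_apply]
  have hcs : ∀ u v, cov G F (fun y => fderiv ℝ F y v) x u
      = cov G F (fun y => fderiv ℝ F y u) x v := fun u v => by
    rw [hc, hc, fderiv_symm_of_contDiffAt hF, H.christoffel_symm (I.mapsTo hx)]
  have hd : ∀ u v w, fderiv ℝ (LocalGeometry.pullback G F) x u v w
      = G (F x) (cov G F (fun y => fderiv ℝ F y v) x u) (fderiv ℝ F x w)
        + G (F x) (fderiv ℝ F x v) (cov G F (fun y => fderiv ℝ F y w) x u) := fun u v w => by
    have hpd := (hP.smooth x hx).differentiableAt (by simp)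
    rw [← H.fderiv_inner (I.mapsTo hx) (hF.differentiableAt (by simp))
      (hF2.clm_apply (differentiableAt_const v)) (hF2.clm_apply (differentiableAt_const w)),
      ← fderiv_apply_const hpd, ← fderiv_apply_const (hpd.clm_apply (differentiableAt_const v))]
    rfl
  rw [secondForm, ← hc, H.normalPart_eq I hx, H.tangentPart_eq I hx
    (r := christoffel (LocalGeometry.pullback G F) x u v), add_sub_cancel]
  intro z
  -- In the Koszul formula for the induced metric, the three derivatives produce six inner products;
  -- torsion-freeness `hcs` cancels four of them and leaves the tangential component twice.
  rw [hP.koszul hx, hd, hd, hd, hcs v u, hcs z v, hcs z u,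
    (H.inner _ (I.mapsTo hx)).symm (fderiv ℝ F x v),
    (H.inner _ (I.mapsTo hx)).symm (fderiv ℝ F x u)]
  ring

theorem secondForm_eq {x : E m} (hx : x ∈ V) (u v : E m) :
    secondForm G F x u v = cov G F (fun y => fderiv ℝ F y v) x u
      - fderiv ℝ F x (christoffel (LocalGeometry.pullback G F) x u v) := by
  rw [H.cov_fderiv I hx, add_sub_cancel_left]

theorem secondForm_orth {x : E m} (hx : x ∈ V) (u v z : E m) :
    G (F x) (secondForm G F x u v) (fderiv ℝ F x z) = 0 :=
  H.normalPart_orth I hx _ _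

theorem contDiffAt_secondForm {x : E m} (hx : x ∈ V) (u v : E m) :
    ContDiffAt ℝ ∞ (fun y => secondForm G F y u v) x := by
  have hF := I.smooth x hx
  have hP := H.pullback I
  have h1 : ContDiffAt ℝ ∞ (fun y => christoffel (LocalGeometry.pullback G F) y u v) x :=
    ((contDiffAt_chr (hP.smooth x hx) (hP.inner x hx)).clm_apply contDiffAt_const).clm_apply
      contDiffAt_const
  have h2 := contDiffAt_cov (H.smooth _ (I.mapsTo hx)) (H.inner _ (I.mapsTo hx)) hF
    (hF.fderiv_infty.clm_apply (contDiffAt_const (c := v))) u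
  refine (h2.sub (hF.fderiv_infty.clm_apply h1)).congr_of_eventuallyEq ?_
  filter_upwards [I.isOpen.mem_nhds hx] with y hy using H.secondForm_eq I hy u v

/-- The second fundamental form as a bilinear map. -/
theorem secondForm_eq_normalPart {x : E m} (hx : x ∈ V) (u v : E m) :
    secondForm G F x u v = fderiv ℝ (fderiv ℝ F) x u v
      + chr G (F x) (fderiv ℝ F x u) (fderiv ℝ F x v)
      - fderiv ℝ F x (chr (LocalGeometry.pullback G F) x u v) := by
  rw [H.secondForm_eq I hx, cov,
    fderiv_apply_const ((I.smooth x hx).fderiv_infty.differentiableAt (by simp)), chr_apply,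
    chr_apply]

theorem secondForm_symm {x : E m} (hx : x ∈ V) (u v : E m) :
    secondForm G F x u v = secondForm G F x v u := by
  rw [secondForm, secondForm, fderiv_symm_of_contDiffAt (I.smooth x hx),
    H.christoffel_symm (I.mapsTo hx)]

/-- The Leibniz extension of the Gauss formula to non-constant tangent fields, needed below for the
field $\Gamma(v,w)$. -/
theorem cov_tangent {x : E m} (hx : x ∈ V) {Z : E m → E m} (hZ : DifferentiableAt ℝ Z x)
    (u : E m) :
    cov G F (fun y => fderiv ℝ F y (Z y)) x u
      = fderiv ℝ F x (fderiv ℝ Z x u + chr (LocalGeometry.pullback G F) x u (Z x))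
        + secondForm G F x u (Z x) := by
  have hF2 := (I.smooth x hx).fderiv_infty.differentiableAt (by simp)
  rw [cov, fderiv_clm_apply hF2 hZ, H.secondForm_eq_normalPart I hx]
  simp only [add_apply, ContinuousLinearMap.coe_comp, Function.comp_apply,
    ContinuousLinearMap.flip_apply, map_add]
  abel

/-- The common source of the Gauss and Codazzi equations: pairing with a tangent vector gives the
former, pairing with the normal the latter. It comes from inserting the Gauss formula twice into
`cov_cov_sub`. -/
theorem curvature_fderiv {x : E m} (hx : x ∈ V) (u v w : E m) :
    curvature G (F x) (fderiv ℝ F x u) (fderiv ℝ F x v) (fderiv ℝ F x w)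
      = fderiv ℝ F x (curvature (LocalGeometry.pullback G F) x u v w)
        + secondForm G F x u (christoffel (LocalGeometry.pullback G F) x v w)
        - secondForm G F x v (christoffel (LocalGeometry.pullback G F) x u w)
        + cov G F (fun y => secondForm G F y v w) x u
        - cov G F (fun y => secondForm G F y u w) x v := by
  have hF := I.smooth x hx
  have hP := H.pullback I
  rw [← cov_cov_sub (V := fun y => fderiv ℝ F y w) (H.smooth _ (I.mapsTo hx))
    (H.inner _ (I.mapsTo hx)) hF (hF.fderiv_infty.clm_apply contDiffAt_const)]
  have key : ∀ u v, cov G F (fun y => cov G F (fun y => fderiv ℝ F y w) y v) x u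
      = fderiv ℝ F x (fderiv ℝ (fun y => christoffel (LocalGeometry.pullback G F) y v w) x u
          + chr (LocalGeometry.pullback G F) x u (christoffel (LocalGeometry.pullback G F) x v w))
        + secondForm G F x u (christoffel (LocalGeometry.pullback G F) x v w)
        + cov G F (fun y => secondForm G F y v w) x u := by
    intro u v
    have hc : DifferentiableAt ℝ (fun y => christoffel (LocalGeometry.pullback G F) y v w) x :=
      ((((contDiffAt_chr (hP.smooth x hx) (hP.inner x hx)).clm_apply
        contDiffAt_const).clm_apply contDiffAt_const).differentiableAt (by simp))
    have hs := (H.contDiffAt_secondForm I hx v w).differentiableAt (by simp)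
    have ht : DifferentiableAt ℝ (fun y => fderiv ℝ F y
        (christoffel (LocalGeometry.pullback G F) y v w)) x :=
      (hF.fderiv_infty.differentiableAt (by simp)).clm_apply hc
    -- The inner covariant derivative is split into tangential and normal fields on a whole
    -- neighbourhood, since it is about to be differentiated.
    rw [cov_congr (W := fun y => fderiv ℝ F y (christoffel (LocalGeometry.pullback G F) y v w)
      + secondForm G F y v w)]
    · rw [← H.cov_tangent I hx hc, cov, fderiv_fun_add ht hs, cov, cov]
      simp only [add_apply, map_add]
      abel
    · filter_upwards [I.isOpen.mem_nhds hx] with y hy using H.cov_fderiv I hy v w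
  rw [key, key, curvature]
  simp only [map_add, map_sub, chr_apply]
  abel

/-- The Weingarten relation: differentiate $\langle A(v,w), dF(z)\rangle = 0$. -/
theorem inner_cov_secondForm {x : E m} (hx : x ∈ V) (u v w z : E m) :
    G (F x) (cov G F (fun y => secondForm G F y v w) x u) (fderiv ℝ F x z)
      = -G (F x) (secondForm G F x v w) (secondForm G F x u z) := by
  have hF := I.smooth x hx
  have h := H.fderiv_inner (I.mapsTo hx) (hF.differentiableAt (by simp))
    ((H.contDiffAt_secondForm I hx v w).differentiableAt (by simp))
    ((hF.fderiv_infty.differentiableAt (by simp)).clm_apply (differentiableAt_const z)) u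
  have h0 : (fun y => G (F y) (secondForm G F y v w) (fderiv ℝ F y z)) =ᶠ[nhds x] fun _ => 0 := by
    filter_upwards [I.isOpen.mem_nhds hx] with y hy using H.secondForm_orth I hy v w z
  rw [h0.fderiv_eq, H.cov_fderiv I hx u z, map_add, H.secondForm_orth I hx] at h
  simp at h
  linarith

/-- The Gauss equation. -/
theorem gauss {x : E m} (hx : x ∈ V) (u v w z : E m) :
    LocalGeometry.pullback G F x (curvature (LocalGeometry.pullback G F) x u v w) z
      = G (F x) (curvature G (F x) (fderiv ℝ F x u) (fderiv ℝ F x v) (fderiv ℝ F x w))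
          (fderiv ℝ F x z)
        + G (F x) (secondForm G F x v w) (secondForm G F x u z)
        - G (F x) (secondForm G F x u w) (secondForm G F x v z) := by
  rw [H.curvature_fderiv I hx]
  simp only [map_add, map_sub, add_apply, sub_apply, H.secondForm_orth I hx,
    H.inner_cov_secondForm I hx, pullback_apply]
  ring

end IsMetricOn

end LocalGeometry

namespace LocalGeometry

/-! ### Change of coordinates -/

section composition

variable {k m n : ℕ} {G : E n → E n →L[ℝ] E n →L[ℝ] ℝ} {U : Set (E n)} {W : Set (E m)}
  {V : Set (E k)} {φ : E k → E m} {ψ : E m → E n}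

/-- This and the next four lemmas record that the local invariants depend only on germs, so that
coordinate expressions agreeing near a point may be exchanged. -/
theorem christoffel_congr {G G' : E n → E n →L[ℝ] E n →L[ℝ] ℝ} {x : E n} (h : G =ᶠ[nhds x] G')
    (u v : E n) : christoffel G x u v = christoffel G' x u v := by
  simp only [christoffel, h.eq_of_nhds, h.fderiv_eq]

theorem curvature_congr {G G' : E n → E n →L[ℝ] E n →L[ℝ] ℝ} {x : E n} (h : G =ᶠ[nhds x] G')
    (u v w : E n) : curvature G x u v w = curvature G' x u v w := by
  have h' : ∀ v w, (fun y => christoffel G y v w) =ᶠ[nhds x] fun y => christoffel G' y v w :=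
    fun v w => by filter_upwards [h.eventuallyEq_nhds] with y hy using christoffel_congr hy v w
  simp only [curvature, (h' _ _).fderiv_eq, (h' _ _).eq_of_nhds]

theorem sectional_congr {G G' : E n → E n →L[ℝ] E n →L[ℝ] ℝ} {x : E n} (h : G =ᶠ[nhds x] G')
    (u v : E n) : sectional G x u v = sectional G' x u v := by
  simp only [sectional, curvature_congr h, h.eq_of_nhds]

theorem laplace_congr {G G' : E n → E n →L[ℝ] E n →L[ℝ] ℝ} {f f' : E n → ℝ} {x : E n}
    (h : G =ᶠ[nhds x] G') (hf : f =ᶠ[nhds x] f') : laplace G f x = laplace G' f' x := by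
  simp only [laplace, christoffel_congr h, h.eq_of_nhds, hf.fderiv_eq, hf.fderiv.fderiv_eq]

theorem secondForm_congr {G G' : E n → E n →L[ℝ] E n →L[ℝ] ℝ} {F F' : E m → E n} {x : E m}
    (h : G =ᶠ[nhds (F x)] G') (hF : F =ᶠ[nhds x] F') (u v : E m) :
    secondForm G F x u v = secondForm G' F' x u v := by
  simp only [secondForm, normalPart, hF.fderiv_eq, hF.fderiv.fderiv_eq, ← hF.eq_of_nhds,
    christoffel_congr h, h.eq_of_nhds]

theorem IsImmersionOn.comp (J : IsImmersionOn ψ W U) (I : IsImmersionOn φ V W) :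
    IsImmersionOn (ψ ∘ φ) V U where
  isOpen := I.isOpen
  smooth y hy := (J.smooth _ (I.mapsTo hy)).comp y (I.smooth y hy)
  mapsTo := J.mapsTo.comp I.mapsTo
  injective y hy := by
    rw [fderiv_comp y ((J.smooth _ (I.mapsTo hy)).differentiableAt (by simp))
      ((I.smooth y hy).differentiableAt (by simp))]
    exact (J.injective _ (I.mapsTo hy)).comp (I.injective y hy)

theorem IsImmersionOn.fderiv_comp (J : IsImmersionOn ψ W U) (I : IsImmersionOn φ V W) {x : E k}
    (hx : x ∈ V) : fderiv ℝ (ψ ∘ φ) x = (fderiv ℝ ψ (φ x)).comp (fderiv ℝ φ x) :=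
  _root_.fderiv_comp x ((J.smooth _ (I.mapsTo hx)).differentiableAt (by simp))
      ((I.smooth x hx).differentiableAt (by simp))

theorem pullback_comp (J : IsImmersionOn ψ W U) (I : IsImmersionOn φ V W)
    (G : E n → E n →L[ℝ] E n →L[ℝ] ℝ) {x : E k} (hx : x ∈ V) :
    pullback G (ψ ∘ φ) x = pullback (pullback G ψ) φ x := by
  ext u v
  simp only [pullback_apply, J.fderiv_comp I hx]
  rfl

/-- The second fundamental form of a composition of immersions. -/
theorem IsMetricOn.secondForm_comp (H : IsMetricOn G U) (J : IsImmersionOn ψ W U)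
    (I : IsImmersionOn φ V W) {x : E k} (hx : x ∈ V) (u v : E k) :
    secondForm G (ψ ∘ φ) x u v
      = secondForm G ψ (φ x) (fderiv ℝ φ x u) (fderiv ℝ φ x v)
        + fderiv ℝ ψ (φ x) (secondForm (LocalGeometry.pullback G ψ) φ x u v) := by
  have hφ := (I.smooth x hx)
  have hψ := J.smooth _ (I.mapsTo hx)
  rw [H.secondForm_eq_normalPart (J.comp I) hx, H.secondForm_eq_normalPart J (I.mapsTo hx),
    (H.pullback J).secondForm_eq_normalPart I hx]
  have h1 : fderiv ℝ (ψ ∘ φ) =ᶠ[nhds x] fun y => (fderiv ℝ ψ (φ y)).comp (fderiv ℝ φ y) := by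
    filter_upwards [I.isOpen.mem_nhds hx] with y hy using J.fderiv_comp I hy
  have hd : DifferentiableAt ℝ (fderiv ℝ ψ) (φ x) := hψ.fderiv_infty.differentiableAt (by simp)
  have hd' : DifferentiableAt ℝ (fun y => fderiv ℝ ψ (φ y)) x :=
    hd.comp x (hφ.differentiableAt (by simp))
  have h2 : fderiv ℝ (fderiv ℝ (ψ ∘ φ)) x u v
      = fderiv ℝ (fderiv ℝ ψ) (φ x) (fderiv ℝ φ x u) (fderiv ℝ φ x v)
        + fderiv ℝ ψ (φ x) (fderiv ℝ (fderiv ℝ φ) x u v) := by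
    have h3 : fderiv ℝ (fun y => fderiv ℝ ψ (φ y)) x
        = (fderiv ℝ (fderiv ℝ ψ) (φ x)).comp (fderiv ℝ φ x) :=
      _root_.fderiv_comp x hd (hφ.differentiableAt (by simp))
    rw [h1.fderiv_eq, fderiv_clm_comp hd' (hφ.fderiv_infty.differentiableAt (by simp)), h3]
    simp
    abel
  have h4 : chr (LocalGeometry.pullback G (ψ ∘ φ)) x u v
      = chr (LocalGeometry.pullback (LocalGeometry.pullback G ψ) φ) x u v := by
    refine christoffel_congr ?_ u v
    filter_upwards [I.isOpen.mem_nhds hx] with y hy using pullback_comp J I G hy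
  rw [h2, h4, J.fderiv_comp I hx]
  simp only [Function.comp_apply, ContinuousLinearMap.coe_comp, map_add, map_sub]
  abel

/-- A local diffeomorphism has vanishing second fundamental form. -/
theorem IsMetricOn.secondForm_eq_zero {ψ : E n → E n} {W : Set (E n)} (H : IsMetricOn G U)
    (J : IsImmersionOn ψ W U) {x : E n} (hx : x ∈ W) (u v : E n) : secondForm G ψ x u v = 0 := by
  refine (H.inner _ (J.mapsTo hx)).eq_zero fun w => ?_
  -- In equal dimensions the injective differential is onto, so a vector orthogonal to its image is
  -- orthogonal to everything.
  have hs : Function.Surjective (fderiv ℝ ψ x : E n →ₗ[ℝ] E n) :=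
    LinearMap.injective_iff_surjective.1 (J.injective x hx)
  obtain ⟨z, rfl⟩ := hs w
  exact H.secondForm_orth J hx u v z

end composition

/-! ### Symmetries of the curvature tensor -/

variable {m n : ℕ} {G : E n → E n →L[ℝ] E n →L[ℝ] ℝ} {U : Set (E n)}
  {F : E m → E n} {V : Set (E m)}

namespace IsMetricOn

variable (H : IsMetricOn G U)
include H

theorem curvature_eq {y : E n} (hy : y ∈ U) (u v w : E n) :
    curvature G y u v w = fderiv ℝ (chr G) y u v w - fderiv ℝ (chr G) y v u w
      + chr G y u (chr G y v w) - chr G y v (chr G y u w) := by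
  have hchr := (contDiffAt_chr (H.smooth y hy) (H.inner y hy)).differentiableAt (by simp)
  have hcurv : ∀ a b c, fderiv ℝ (fun y => christoffel G y b c) y a
      = fderiv ℝ (chr G) y a b c := by
    intro a b c
    simp only [← chr_apply]
    rw [fderiv_apply_const (hchr.clm_apply (differentiableAt_const b)), fderiv_apply_const hchr]
  rw [curvature, hcurv, hcurv]
  rfl

omit H in
theorem curvature_antisymm (u v w y : E n) : curvature G y u v w = -curvature G y v u w := by
  simp only [curvature]; abel

theorem bianchi {y : E n} (hy : y ∈ U) (u v w : E n) :
    curvature G y u v w + curvature G y v w u + curvature G y w u v = 0 := by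
  have h : ∀ u v, (fun z => christoffel G z u v) =ᶠ[nhds y] fun z => christoffel G z v u := by
    intro u v
    filter_upwards [H.mem_nhds hy] with z hz using H.christoffel_symm hz u v
  simp only [curvature]
  rw [(h w u).fderiv_eq, (h v u).fderiv_eq, (h w v).fderiv_eq, H.christoffel_symm hy w u,
    H.christoffel_symm hy w v, H.christoffel_symm hy v u]
  abel

/-- The function $y\mapsto G_y(w,z)$ has a symmetric second derivative. Computing it by metric
compatibility, for constant fields along the identity map, leaves exactly the skewness of $R(u,v)$.
-/
theorem curvature_skew {y : E n} (hy : y ∈ U) (u v w z : E n) :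
    G y (curvature G y u v w) z = -G y w (curvature G y u v z) := by
  have hid : ∀ y : E n, ContDiffAt ℝ ∞ (id : E n → E n) y := fun y => contDiffAt_id
  have hG := H.smooth y hy
  let f : E n → ℝ := fun y => G y w z
  have hf : ContDiffAt ℝ ∞ f y := (hG.clm_apply contDiffAt_const).clm_apply contDiffAt_const
  have hc : ∀ v w : E n, DifferentiableAt ℝ (fun y => cov G id (fun _ => w) y v) y := fun v w =>
    (contDiffAt_cov (F := id) hG (H.inner y hy) (hid y) contDiffAt_const v).differentiableAt
      (by simp)
  have hfd : ∀ v, (fun x => fderiv ℝ f x v) =ᶠ[nhds y] fun x =>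
      G x (cov G id (fun _ => w) x v) z + G x w (cov G id (fun _ => z) x v) := by
    intro v
    filter_upwards [H.mem_nhds hy] with x hx
    exact H.fderiv_inner (F := id) (V := fun _ => w) (W := fun _ => z) hx differentiableAt_id
      (differentiableAt_const w) (differentiableAt_const z) v
  have hGd := hG.differentiableAt (by simp)
  have h2 : ∀ u v, fderiv ℝ (fderiv ℝ f) y u v
      = G y (cov G id (fun x => cov G id (fun _ => w) x v) y u) z
        + G y (cov G id (fun _ => w) y v) (cov G id (fun _ => z) y u)
        + (G y (cov G id (fun _ => w) y u) (cov G id (fun _ => z) y v)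
        + G y w (cov G id (fun x => cov G id (fun _ => z) x v) y u)) := by
    intro u v
    rw [← fderiv_apply_const (hf.fderiv_infty.differentiableAt (by simp)), (hfd v).fderiv_eq,
      fderiv_fun_add ((hGd.clm_apply (hc v w)).clm_apply (differentiableAt_const z))
        ((hGd.clm_apply (differentiableAt_const w)).clm_apply (hc v z)), add_apply]
    congr 1
    · exact H.fderiv_inner (F := id) (V := fun x => cov G id (fun _ => w) x v) (W := fun _ => z) hy
        differentiableAt_id (hc v w) (differentiableAt_const z) u
    · exact H.fderiv_inner (F := id) (W := fun x => cov G id (fun _ => z) x v) (V := fun _ => w) hy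
        differentiableAt_id (differentiableAt_const w) (hc v z) u
  have h3 := fderiv_symm_of_contDiffAt hf u v
  rw [h2, h2] at h3
  have hR : ∀ w, curvature G y u v w = cov G id (fun x => cov G id (fun _ => w) x v) y u
      - cov G id (fun x => cov G id (fun _ => w) x u) y v := fun w => by
    rw [cov_cov_sub (F := id) (V := fun _ => w) hG (H.inner y hy) (hid y) contDiffAt_const]
    simp
  rw [hR w, hR z, map_sub, map_sub, sub_apply]
  linarith

/-- Self-adjointness of the Jacobi operator $R(\cdot,v)v$: the case of pair symmetry that is needed,
obtained from the Bianchi identity and the two skew symmetries. -/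
theorem curvature_pair {y : E n} (hy : y ∈ U) (u v z : E n) :
    G y (curvature G y u v v) z = G y (curvature G y z v v) u := by
  have h1 := congrArg (fun a => G y a v) (H.bianchi hy u v z)
  simp only [map_add, add_apply, map_zero, zero_apply] at h1
  have h2 := H.curvature_skew hy z u v v
  have h3 := H.curvature_skew hy u v v z
  have h4 := H.curvature_skew hy z v v u
  have h5 : G y (curvature G y v z u) v = -G y (curvature G y z v u) v := by
    rw [curvature_antisymm]; simp
  have s := (H.inner y hy).symm
  rw [s v] at h2 h3 h4
  linarith

/-- In a space of constant curvature the sectional curvatures determine `⟨R(u,v)v,u⟩`. -/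
theorem curvature_of_sectional {κ : ℝ} {y : E n} (hy : y ∈ U)
    (hs : ∀ u v, LinearIndependent ℝ ![u, v] → sectional G y u v = κ) (u v : E n) :
    G y (curvature G y u v v) u = κ * (G y u u * G y v v - G y u v ^ 2) := by
  have s := (H.inner y hy).symm
  by_cases hli : LinearIndependent ℝ ![u, v]
  · rw [← hs u v hli, sectional, div_mul_cancel₀]
    intro h0
    have hv : v ≠ 0 := hli.ne_zero 1
    have hvv := (H.inner y hy).pos v hv
    -- The Gram–Schmidt vector: its square length is $|v|^2$ times the Gram determinant of `u` and
    -- `v`, which is therefore positive.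
    have hz : G y v v • u - G y u v • v ≠ 0 := by
      intro h
      have := LinearIndependent.pair_iff.1 hli (G y v v) (-G y u v) (by rw [← h]; module)
      exact hvv.ne' this.1
    have hp := (H.inner y hy).pos _ hz
    simp only [map_sub, map_smul, sub_apply, smul_apply, smul_eq_mul, s v u] at hp
    have : 0 < G y v v * (G y u u * G y v v - G y u v ^ 2) := by nlinarith
    rw [h0, mul_zero] at this
    exact lt_irrefl _ this
  · have hvu : ∃ a b : ℝ, (a ≠ 0 ∨ b ≠ 0) ∧ a • u + b • v = 0 := by
      by_contra hcon
      push Not at hcon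
      refine hli (LinearIndependent.pair_iff.2 fun a b hab => ?_)
      by_contra hne
      refine hcon a b ?_ hab
      tauto
    have hR0 : ∀ v w, curvature G y v v w = 0 := fun v w => by simp [curvature]
    obtain ⟨a, b, hab, h⟩ := hvu
    by_cases ha : a = 0
    · subst ha
      have hb : b ≠ 0 := by tauto
      have hv : v = 0 := by simpa [hb] using h
      rw [hv, H.curvature_eq hy]
      simp
    · have hu : u = (-(b / a)) • v := by
        have : a • u = (-b) • v := by rw [eq_comm, ← sub_eq_zero, ← neg_eq_zero, ← h]; module
        rw [← inv_smul_smul₀ ha u, this, smul_smul]; congr 1; ring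
      have : curvature G y u v v = 0 := by
        rw [hu, ← smul_zero (-(b / a)), ← hR0 v v, H.curvature_eq hy, H.curvature_eq hy]
        simp only [map_smul, smul_apply]
        module
      rw [this, hu]
      simp only [map_smul, smul_apply, map_zero, zero_apply, smul_eq_mul]
      ring

theorem curvature_add_left {y : E n} (hy : y ∈ U) (u u' v w : E n) :
    curvature G y (u + u') v w = curvature G y u v w + curvature G y u' v w := by
  simp only [H.curvature_eq hy, map_add, add_apply]
  abel

/-- In a space of constant curvature, `R(u, v)v` lies in the span of `u` and `v`. -/
theorem curvature_normal {κ : ℝ} {y : E n} (hy : y ∈ U)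
    (hs : ∀ u v, LinearIndependent ℝ ![u, v] → sectional G y u v = κ) {u v z : E n}
    (hu : G y z u = 0) (hv : G y z v = 0) : G y (curvature G y u v v) z = 0 := by
  have s := (H.inner y hy).symm
  -- Polarization of the quadratic form $u\mapsto\langle R(u,v)v,u\rangle$: the mixed term is
  -- $2\langle R(u,v)v,z\rangle$ by `curvature_pair`, while on the right-hand side it vanishes as
  -- `z` is orthogonal to `u` and `v`.
  have h1 := H.curvature_of_sectional hy hs (u + z) v
  have h2 := H.curvature_of_sectional hy hs u v
  have h3 := H.curvature_of_sectional hy hs z v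
  have h4 := H.curvature_pair hy u v z
  rw [H.curvature_add_left hy] at h1
  simp only [map_add, add_apply, s u z, hu, hv] at h1 h2 h3
  nlinarith

end IsMetricOn

/-- `N` is a smooth unit normal field that spans the normal spaces of the hypersurface `F`. -/
structure IsUnitNormal (G : E n → E n →L[ℝ] E n →L[ℝ] ℝ) (F : E m → E n) (V : Set (E m))
    (N : E m → E n) : Prop where
  smooth : ∀ y ∈ V, ContDiffAt ℝ ∞ N y
  orth : ∀ y ∈ V, ∀ z, G (F y) (N y) (fderiv ℝ F y z) = 0
  unit : ∀ y ∈ V, G (F y) (N y) (N y) = 1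
  span : ∀ y ∈ V, ∀ w, (∀ z, G (F y) w (fderiv ℝ F y z) = 0) → w = G (F y) w (N y) • N y

/-- The scalar second fundamental form with respect to the normal field `N`. -/
def scalarForm (G : E n → E n →L[ℝ] E n →L[ℝ] ℝ) (F N : E m → E n) (x u v : E m) : ℝ :=
  G (F x) (secondForm G F x u v) (N x)

variable {N : E m → E n}

theorem IsUnitNormal.secondForm_eq (K : IsUnitNormal G F V N) (H : IsMetricOn G U)
    (I : IsImmersionOn F V U) {x : E m} (hx : x ∈ V) (u v : E m) :
    secondForm G F x u v = scalarForm G F N x u v • N x :=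
  K.span x hx _ (H.secondForm_orth I hx u v)

theorem IsUnitNormal.inner_secondForm (K : IsUnitNormal G F V N) (H : IsMetricOn G U)
    (I : IsImmersionOn F V U) {x : E m} (hx : x ∈ V) (u v w z : E m) :
    G (F x) (secondForm G F x u v) (secondForm G F x w z)
      = scalarForm G F N x u v * scalarForm G F N x w z := by
  rw [K.secondForm_eq H I hx u v, K.secondForm_eq H I hx w z]
  simp [K.unit x hx, mul_comm]

theorem IsUnitNormal.contDiffAt_scalarForm (K : IsUnitNormal G F V N) (H : IsMetricOn G U)
    (I : IsImmersionOn F V U) {x : E m} (hx : x ∈ V) (u v : E m) :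
    ContDiffAt ℝ ∞ (fun y => scalarForm G F N y u v) x :=
  (((H.smooth _ (I.mapsTo hx)).comp x (I.smooth x hx)).clm_apply
    (H.contDiffAt_secondForm I hx u v)).clm_apply (K.smooth x hx)

/-- The derivative of the unit field `N` is orthogonal to `N`, and the second fundamental form is a
multiple of `N`, so differentiating `N` contributes nothing. -/
theorem IsUnitNormal.fderiv_scalarForm (K : IsUnitNormal G F V N) (H : IsMetricOn G U)
    (I : IsImmersionOn F V U) {x : E m} (hx : x ∈ V) (u v w : E m) :
    fderiv ℝ (fun y => scalarForm G F N y v w) x u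
      = G (F x) (cov G F (fun y => secondForm G F y v w) x u) (N x) := by
  have hF := (I.smooth x hx).differentiableAt (by simp)
  have hN := (K.smooth x hx).differentiableAt (by simp)
  have h1 := H.fderiv_inner (I.mapsTo hx) hF hN hN u
  have h0 : (fun y => G (F y) (N y) (N y)) =ᶠ[nhds x] fun _ => 1 := by
    filter_upwards [I.isOpen.mem_nhds hx] with y hy using K.unit y hy
  rw [h0.fderiv_eq, (H.inner _ (I.mapsTo hx)).symm _ (N x)] at h1
  have h2 : G (F x) (N x) (cov G F N x u) = 0 := by
    simp at h1; linarith
  unfold scalarForm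
  rw [H.fderiv_inner (I.mapsTo hx) hF
    ((H.contDiffAt_secondForm I hx v w).differentiableAt (by simp)) hN,
    K.secondForm_eq H I hx v w]
  simp [h2]

/-- The Codazzi equation in a space of constant curvature. -/
theorem IsUnitNormal.codazzi (K : IsUnitNormal G F V N) (H : IsMetricOn G U)
    (I : IsImmersionOn F V U) {κ : ℝ} {x : E m} (hx : x ∈ V)
    (hs : ∀ u v, LinearIndependent ℝ ![u, v] → sectional G (F x) u v = κ) (u v : E m) :
    fderiv ℝ (fun y => scalarForm G F N y v v) x u - fderiv ℝ (fun y => scalarForm G F N y u v) x v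
      = scalarForm G F N x v (christoffel (pullback G F) x u v)
        - scalarForm G F N x u (christoffel (pullback G F) x v v) := by
  have h := H.curvature_normal (I.mapsTo hx) hs (K.orth x hx u) (K.orth x hx v)
  rw [H.curvature_fderiv I hx] at h
  simp only [map_add, map_sub, add_apply, sub_apply, ← K.fderiv_scalarForm H I hx] at h
  rw [(H.inner _ (I.mapsTo hx)).symm, K.orth x hx] at h
  simp only [scalarForm] at h ⊢
  linarith

end LocalGeometry

namespace LocalGeometry

/-! ### Simons' identity for trace-free Codazzi tensors on surfaces -/

/-- The polynomial identity between the 2-jet of a trace-free Codazzi tensor `(L, M, N)` and the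
1-jet of the Christoffel symbols at a point where the coordinate frame is orthonormal. -/
theorem simons_jet
  {g1 g2 m1 m2 n1 n2 g1u g1v g2u g2v m1u m1v m2u m2v n1u n1v n2u n2v
   Eu Ev Fu Fv Gu Gv Euu Euv Evu Evv Fuu Fuv Fvu Fvv Guu Guv Gvu Gvv
   L M N Lu Lv Mu Mv Nu Nv Luu Luv Lvv Muu Muv Mvv Nuu Nuv Nvv Du Dv Duu Dvv lu lv luu lvv K : ℝ}
  (hEu : Eu = 2 * g1) (hEv : Ev = 2 * m1) (hFu : Fu = g2 + m1) (hFv : Fv = m2 + n1)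
  (hGu : Gu = 2 * m2) (hGv : Gv = 2 * n2)
  (hEuu : Euu = 2 * (g1u + g1 * Eu + g2 * Fu))
  (hEuv : Euv = 2 * (g1v + g1 * Ev + g2 * Fv))
  (hEvu : Evu = 2 * (m1u + m1 * Eu + m2 * Fu))
  (hEvv : Evv = 2 * (m1v + m1 * Ev + m2 * Fv))
  (hEs : Euv = Evu)
  (hFuu : Fuu = (g1 * Fu + g2u + g2 * Gu) + (m1u + m1 * Eu + m2 * Fu))
  (hFuv : Fuv = (g1 * Fv + g2v + g2 * Gv) + (m1v + m1 * Ev + m2 * Fv))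
  (hFvu : Fvu = (m1 * Fu + m2u + m2 * Gu) + (n1u + n1 * Eu + n2 * Fu))
  (hFvv : Fvv = (m1 * Fv + m2v + m2 * Gv) + (n1v + n1 * Ev + n2 * Fv))
  (hFs : Fuv = Fvu)
  (hGuu : Guu = 2 * (m1 * Fu + m2u + m2 * Gu))
  (hGuv : Guv = 2 * (m1 * Fv + m2v + m2 * Gv))
  (hGvu : Gvu = 2 * (n1 * Fu + n2u + n2 * Gu))
  (hGvv : Gvv = 2 * (n1 * Fv + n2v + n2 * Gv))
  (hGs : Guv = Gvu)
  (hN : N = - L)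
  (hNu : Nu = -(Eu * N - 2 * Fu * M + Gu * L + Lu))
  (hNv : Nv = -(Ev * N - 2 * Fv * M + Gv * L + Lv))
  (hMv : Mv = Nu - (m1 * M + m2 * N - n1 * L - n2 * M))
  (hMu : Mu = Lv - (m1 * L + m2 * M - g1 * M - g2 * N))
  (hNuu : Nuu = -(Euu * N + 2 * Eu * Nu - 2 * (Fuu * M + 2 * Fu * Mu) + Guu * L + 2 * Gu * Lu
    + Luu))
  (hNvv : Nvv = -(Evv * N + 2 * Ev * Nv - 2 * (Fvv * M + 2 * Fv * Mv) + Gvv * L + 2 * Gv * Lv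
    + Lvv))
  (hNuv : Nuv = -(Euv * N + Eu * Nv + Ev * Nu - 2 * (Fuv * M + Fu * Mv + Fv * Mu) + Guv * L
    + Gu * Lv + Gv * Lu + Luv))
  (hMuu : Muu = Luv - (m1u * L + m1 * Lu + m2u * M + m2 * Mu - g1u * M - g1 * Mu - g2u * N
    - g2 * Nu))
  (hMuv : Muv = Lvv - (m1v * L + m1 * Lv + m2v * M + m2 * Mv - g1v * M - g1 * Mv - g2v * N
    - g2 * Nv))
  (hMvu : Muv = Nuu - (m1u * M + m1 * Mu + m2u * N + m2 * Nu - n1u * L - n1 * Lu - n2u * M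
    - n2 * Mu))
  (hMvv : Mvv = Nuv - (m1v * M + m1 * Mv + m2v * N + m2 * Nv - n1v * L - n1 * Lv - n2v * M
    - n2 * Mv))
  (hDu : Du = 2 * M * Mu - Lu * N - L * Nu)
  (hDv : Dv = 2 * M * Mv - Lv * N - L * Nv)
  (hDuu : Duu = 2 * Mu ^ 2 + 2 * M * Muu - Luu * N - 2 * Lu * Nu - L * Nuu)
  (hDvv : Dvv = 2 * Mv ^ 2 + 2 * M * Mvv - Lvv * N - 2 * Lv * Nv - L * Nvv)
  (hlu : lu * (M ^ 2 + L ^ 2) = Du - 2 * (g1 + m2) * (M ^ 2 + L ^ 2))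
  (hlv : lv * (M ^ 2 + L ^ 2) = Dv - 2 * (m1 + n2) * (M ^ 2 + L ^ 2))
  (hluu : luu * (M ^ 2 + L ^ 2) ^ 2 = Duu * (M ^ 2 + L ^ 2) - Du ^ 2
    - 2 * (g1u + m2u) * (M ^ 2 + L ^ 2) ^ 2)
  (hlvv : lvv * (M ^ 2 + L ^ 2) ^ 2 = Dvv * (M ^ 2 + L ^ 2) - Dv ^ 2
    - 2 * (m1v + n2v) * (M ^ 2 + L ^ 2) ^ 2)
  (hK : K = n1u - m1v + (n1 * g1 + n2 * m1) - (m1 * m1 + m2 * n1)) :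
  (luu + lvv - (g1 + n1) * lu - (g2 + n2) * lv - 4 * K) * (M ^ 2 + L ^ 2) ^ 2 = 0 := by
  -- Multiplication by the square of $D = M^2+L^2$ clears the denominators of the logarithmic
  -- derivatives; the $-2(\dots)$ terms in `hlu`, `hluu` come from $\log(eg-f^2)$.
  have key : (luu + lvv - (g1 + n1) * lu - (g2 + n2) * lv - 4 * K) * (M ^ 2 + L ^ 2) ^ 2 =
    (Duu + Dvv - (g1 + n1) * (Du - 2 * (g1 + m2) * (M ^ 2 + L ^ 2))
      - (g2 + n2) * (Dv - 2 * (m1 + n2) * (M ^ 2 + L ^ 2))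
     - (2 * (g1u + m2u) + 2 * (m1v + n2v) + 4 * K) * (M ^ 2 + L ^ 2)) * (M ^ 2 + L ^ 2)
      - Du ^ 2 - Dv ^ 2 := by
    linear_combination hluu + hlvv - (g1 + n1) * (M ^ 2 + L ^ 2) * hlu
      - (g2 + n2) * (M ^ 2 + L ^ 2) * hlv
  rw [key]
  clear key hluu hlvv hlu hlv
  -- Equality of the mixed second derivatives of each metric component determines one derivative of
  -- a Christoffel symbol; this is how the 2-jet of the metric enters. Likewise `hL` compares the
  -- two expressions for $M_{uv}$ and yields the second-order equation for `L`.
  have hs1 : g1v = (2 * (m1u + m1 * Eu + m2 * Fu)) / 2 - (g1 * Ev + g2 * Fv) := by linarith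
  have hs2 : n2u = (2 * (m1 * Fv + m2v + m2 * Gv)) / 2 - (n1 * Fu + n2 * Gu) := by linarith
  have hs3 : g2v = (m1 * Fu + m2u + m2 * Gu) + (n1u + n1 * Eu + n2 * Fu) - (g1 * Fv + g2 * Gv)
     - (m1v + m1 * Ev + m2 * Fv) := by linarith
  have hL : Lvv = Nuu - (m1u * M + m1 * Mu + m2u * N + m2 * Nu - n1u * L - n1 * Lu - n2u * M
    - n2 * Mu)
    + (m1v * L + m1 * Lv + m2v * M + m2 * Mv - g1v * M - g1 * Mv - g2v * N - g2 * Nv) := by linarith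
  clear hEs hFs hGs hMuv hMvu
  subst hK hDuu hDvv hDu hDv hMvv hMuu hNuv hNvv hL hNuu hMu hMv hNu hNv hN hGvv hGvu hGuv hGuu
    hFvv hFvu hFuv hFuu hEvv hEvu hEuv hEuu hs1 hs2 hs3 hEu hEv hFu hFv hGu hGv
  ring

/-! ### Directional derivatives of functions, and Simons' identity in components. -/

section functions

variable {X : Type*} [NormedAddCommGroup X] [NormedSpace ℝ X]

/-- The derivative of `f` in the direction `u`, as a function. -/
def dirDeriv (u : X) (f : X → ℝ) (y : X) : ℝ := fderiv ℝ f y u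

variable {x u v : X} {V : Set X} {f k : X → ℝ}

theorem dirDeriv_congr (hV : IsOpen V) (hx : x ∈ V) (h : ∀ y ∈ V, f y = k y) :
    dirDeriv u f x = dirDeriv u k x := by
  have : f =ᶠ[nhds x] k := by filter_upwards [hV.mem_nhds hx] with y hy using h y hy
  rw [dirDeriv, dirDeriv, this.fderiv_eq]

theorem dirDeriv_add (hf : DifferentiableAt ℝ f x) (hk : DifferentiableAt ℝ k x) :
    dirDeriv u (fun y => f y + k y) x = dirDeriv u f x + dirDeriv u k x := by
  rw [dirDeriv, fderiv_fun_add hf hk]; rfl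

theorem dirDeriv_sub (hf : DifferentiableAt ℝ f x) (hk : DifferentiableAt ℝ k x) :
    dirDeriv u (fun y => f y - k y) x = dirDeriv u f x - dirDeriv u k x := by
  rw [dirDeriv, fderiv_fun_sub hf hk]; rfl

theorem dirDeriv_mul (hf : DifferentiableAt ℝ f x) (hk : DifferentiableAt ℝ k x) :
    dirDeriv u (fun y => f y * k y) x = dirDeriv u f x * k x + f x * dirDeriv u k x := by
  rw [dirDeriv, fderiv_fun_mul hf hk]
  simp [dirDeriv]; ring

theorem dirDeriv_const (c : ℝ) : dirDeriv u (fun _ : X => c) x = 0 := by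
  simp [dirDeriv]

theorem dirDeriv_div (hf : DifferentiableAt ℝ f x) (hk : DifferentiableAt ℝ k x) (h0 : k x ≠ 0) :
    dirDeriv u (fun y => f y / k y) x
      = (dirDeriv u f x * k x - f x * dirDeriv u k x) / k x ^ 2 := by
  have h : HasFDerivAt (fun y => f y / k y) _ x :=
    hf.hasFDerivAt.mul ((hasDerivAt_inv h0).comp_hasFDerivAt x hk.hasFDerivAt)
  rw [dirDeriv, h.fderiv]
  simp [dirDeriv]
  field_simp
  ring

theorem dirDeriv_log (hf : DifferentiableAt ℝ f x) (h0 : f x ≠ 0) :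
    dirDeriv u (fun y => Real.log (f y)) x = dirDeriv u f x / f x := by
  rw [dirDeriv, fderiv.log hf h0]
  simp [dirDeriv]; ring

theorem contDiffAt_dirDeriv (hf : ContDiffAt ℝ ∞ f x) : ContDiffAt ℝ ∞ (dirDeriv u f) x :=
  (hf.fderiv_right (m := ∞) (by simp)).clm_apply contDiffAt_const

theorem dirDeriv_dirDeriv (hf : ContDiffAt ℝ ∞ f x) :
    dirDeriv u (dirDeriv v f) x = fderiv ℝ (fderiv ℝ f) x u v := by
  have hd := (hf.fderiv_right (m := ∞) (by simp)).differentiableAt (by simp)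
  unfold dirDeriv
  rw [fderiv_clm_apply hd (differentiableAt_const v)]
  simp

theorem dirDeriv_comm (hf : ContDiffAt ℝ ∞ f x) :
    dirDeriv u (dirDeriv v f) x = dirDeriv v (dirDeriv u f) x := by
  rw [dirDeriv_dirDeriv hf, dirDeriv_dirDeriv hf]
  exact (hf.isSymmSndFDerivAt (by simpa using ENat.LEInfty.out)).eq u v

/-- Simons' identity, in terms of the components of a metric `(e, f, g)`, its Christoffel symbols
`Γ(u, u) = (g₁, g₂)`, `Γ(u, v) = (m₁, m₂)`, `Γ(v, v) = (n₁, n₂)` and a trace-free Codazzi tensor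
`(L, M, N)` in a constant frame `(u, v)` that is orthonormal at `x`. -/
theorem simons_components (hV : IsOpen V) (hx : x ∈ V)
    {e f g L M N g₁ g₂ m₁ m₂ n₁ n₂ : X → ℝ}
    (he : ∀ y ∈ V, ContDiffAt ℝ ∞ e y) (hf : ∀ y ∈ V, ContDiffAt ℝ ∞ f y)
    (hg : ∀ y ∈ V, ContDiffAt ℝ ∞ g y) (hL : ∀ y ∈ V, ContDiffAt ℝ ∞ L y)
    (hM : ∀ y ∈ V, ContDiffAt ℝ ∞ M y) (hN : ∀ y ∈ V, ContDiffAt ℝ ∞ N y)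
    (hg₁ : DifferentiableAt ℝ g₁ x) (hg₂ : DifferentiableAt ℝ g₂ x)
    (hm₁ : DifferentiableAt ℝ m₁ x) (hm₂ : DifferentiableAt ℝ m₂ x)
    (hn₁ : DifferentiableAt ℝ n₁ x) (hn₂ : DifferentiableAt ℝ n₂ x)
    (heu : ∀ y ∈ V, dirDeriv u e y = 2 * (g₁ y * e y + g₂ y * f y))
    (hev : ∀ y ∈ V, dirDeriv v e y = 2 * (m₁ y * e y + m₂ y * f y))
    (hfu : ∀ y ∈ V, dirDeriv u f y = (g₁ y * f y + g₂ y * g y) + (m₁ y * e y + m₂ y * f y))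
    (hfv : ∀ y ∈ V, dirDeriv v f y = (m₁ y * f y + m₂ y * g y) + (n₁ y * e y + n₂ y * f y))
    (hgu : ∀ y ∈ V, dirDeriv u g y = 2 * (m₁ y * f y + m₂ y * g y))
    (hgv : ∀ y ∈ V, dirDeriv v g y = 2 * (n₁ y * f y + n₂ y * g y))
    (htr : ∀ y ∈ V, (e y * N y - 2 * (f y * M y)) + g y * L y = 0)
    (hcN : ∀ y ∈ V, dirDeriv v M y = dirDeriv u N y
      - (((m₁ y * M y + m₂ y * N y) - n₁ y * L y) - n₂ y * M y))
    (hcL : ∀ y ∈ V, dirDeriv u M y = dirDeriv v L y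
      - (((m₁ y * L y + m₂ y * M y) - g₁ y * M y) - g₂ y * N y))
    (hex : e x = 1) (hfx : f x = 0) (hgx : g x = 1) (hD : M x ^ 2 - L x * N x ≠ 0)
    (hW : ∀ y ∈ V, e y * g y - f y * f y ≠ 0) {φ : X → ℝ}
    (hφ : ∀ y ∈ V, φ y = Real.log (2 * ((M y * M y - L y * N y) / (e y * g y - f y * f y)))) :
    dirDeriv u (dirDeriv u φ) x + dirDeriv v (dirDeriv v φ) x
      - (g₁ x + n₁ x) * dirDeriv u φ x - (g₂ x + n₂ x) * dirDeriv v φ x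
      = 4 * (dirDeriv u n₁ x - dirDeriv v m₁ x + (n₁ x * g₁ x + n₂ x * m₁ x)
        - (m₁ x * m₁ x + m₂ x * n₁ x)) := by
  have dif : ∀ {k : X → ℝ}, (∀ y ∈ V, ContDiffAt ℝ ∞ k y) → ∀ y ∈ V, DifferentiableAt ℝ k y :=
    fun hk y hy => (hk y hy).differentiableAt (by simp)
  have ddif : ∀ {k : X → ℝ} (w : X), (∀ y ∈ V, ContDiffAt ℝ ∞ k y) →
      DifferentiableAt ℝ (dirDeriv w k) x :=
    fun w hk => (contDiffAt_dirDeriv (hk x hx)).differentiableAt (by simp)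
  have de := dif he x hx
  have df := dif hf x hx
  have dg := dif hg x hx
  have dL := dif hL x hx
  have dM := dif hM x hx
  have dN := dif hN x hx
  have deu := ddif u he
  have dev := ddif v he
  have dfu := ddif u hf
  have dfv := ddif v hf
  have dgu := ddif u hg
  have dgv := ddif v hg
  have dLu := ddif u hL
  have dLv := ddif v hL
  have dMu := ddif u hM
  have dMv := ddif v hM
  have dNu := ddif u hN
  have dNv := ddif v hN
  have htr1 : ∀ w, ∀ y ∈ V, (dirDeriv w e y * N y + e y * dirDeriv w N y
      - 2 * (dirDeriv w f y * M y + f y * dirDeriv w M y))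
      + (dirDeriv w g y * L y + g y * dirDeriv w L y) = 0 := by
    intro w y hy
    have h := dirDeriv_congr (u := w) hV hy htr
    have de := dif he y hy
    have df := dif hf y hy
    have dg := dif hg y hy
    have dL := dif hL y hy
    have dM := dif hM y hy
    have dN := dif hN y hy
    simpa (disch := fun_prop) only [dirDeriv_add, dirDeriv_sub, dirDeriv_mul, dirDeriv_const,
      zero_mul, zero_add] using h
  -- `D` and `W` are made opaque, so that the rules for quotients and logarithms treat them as
  -- single functions.
  obtain ⟨D, hDe⟩ : ∃ D : X → ℝ, ∀ y, D y = M y * M y - L y * N y := ⟨_, fun _ => rfl⟩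
  obtain ⟨W, hWe⟩ : ∃ W : X → ℝ, ∀ y, W y = e y * g y - f y * f y := ⟨_, fun _ => rfl⟩
  have hDs : ∀ y ∈ V, ContDiffAt ℝ ∞ D y := fun y hy => by
    rw [funext hDe]
    exact ((hM y hy).mul (hM y hy)).sub ((hL y hy).mul (hN y hy))
  have hWs : ∀ y ∈ V, ContDiffAt ℝ ∞ W y := fun y hy => by
    rw [funext hWe]
    exact ((he y hy).mul (hg y hy)).sub ((hf y hy).mul (hf y hy))
  have hD1 : ∀ w, ∀ y ∈ V, dirDeriv w D y = (dirDeriv w M y * M y + M y * dirDeriv w M y)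
      - (dirDeriv w L y * N y + L y * dirDeriv w N y) := by
    intro w y hy
    have dL := dif hL y hy
    have dM := dif hM y hy
    have dN := dif hN y hy
    rw [funext hDe]
    simp (disch := fun_prop) only [dirDeriv_sub, dirDeriv_mul]
  have hW1 : ∀ w, ∀ y ∈ V, dirDeriv w W y = (dirDeriv w e y * g y + e y * dirDeriv w g y)
      - (dirDeriv w f y * f y + f y * dirDeriv w f y) := by
    intro w y hy
    have de := dif he y hy
    have df := dif hf y hy
    have dg := dif hg y hy
    rw [funext hWe]
    simp (disch := fun_prop) only [dirDeriv_sub, dirDeriv_mul]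
  have hW0 : ∀ y ∈ V, W y ≠ 0 := fun y hy => by rw [hWe]; exact hW y hy
  have hNx : N x = -L x := by
    have := htr x hx
    rw [hex, hfx, hgx] at this
    linarith
  have hDx : D x = M x ^ 2 + L x ^ 2 := by rw [hDe, hNx]; ring
  have hDx0 : D x ≠ 0 := by rw [hDe]; simpa [sq] using hD
  -- The logarithm splits as $\log 2+\log D-\log W$ only where $D\ne0$, hence the smaller
  -- neighbourhood.
  set V' : Set X := V ∩ {y | D y ≠ 0} with hV'
  have hDc : ContinuousOn D V := fun y hy => (hDs y hy).continuousAt.continuousWithinAt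
  have hV'o : IsOpen V' := hDc.isOpen_inter_preimage hV isOpen_ne
  have hx' : x ∈ V' := ⟨hx, hDx0⟩
  have hφ0 : ∀ y ∈ V', φ y = (Real.log 2 + Real.log (D y)) - Real.log (W y) := fun y hy => by
    rw [hφ y hy.1, ← hDe, ← hWe, Real.log_mul two_ne_zero (div_ne_zero hy.2 (hW0 y hy.1)),
      Real.log_div hy.2 (hW0 y hy.1)]
    ring
  have hφ1 : ∀ w, ∀ y ∈ V', dirDeriv w φ y = dirDeriv w D y / D y - dirDeriv w W y / W y := by
    intro w y hy
    have dD := dif hDs y hy.1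
    have dW := dif hWs y hy.1
    have hlD := dD.log hy.2
    have hlW := dW.log (hW0 y hy.1)
    rw [dirDeriv_congr hV'o hy hφ0, dirDeriv_sub (by fun_prop) hlW,
      dirDeriv_add (by fun_prop) hlD, dirDeriv_log dD hy.2, dirDeriv_log dW (hW0 y hy.1),
      dirDeriv_const, zero_add]
  -- The logarithmic derivative of the metric determinant `W` is twice the trace of the Christoffel
  -- symbols, here $2(g_1+m_2)$.
  have hφu : ∀ y ∈ V', dirDeriv u φ y = dirDeriv u D y / D y - 2 * (g₁ y + m₂ y) := by
    intro y hy
    rw [hφ1 u y hy, hW1 u y hy.1, heu y hy.1, hfu y hy.1, hgu y hy.1]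
    congr 1
    rw [div_eq_iff (hW0 y hy.1), hWe]
    ring
  have hφv : ∀ y ∈ V', dirDeriv v φ y = dirDeriv v D y / D y - 2 * (m₁ y + n₂ y) := by
    intro y hy
    rw [hφ1 v y hy, hW1 v y hy.1, hev y hy.1, hfv y hy.1, hgv y hy.1]
    congr 1
    rw [div_eq_iff (hW0 y hy.1), hWe]
    ring
  have dD := dif hDs x hx
  have dDu := ddif u hDs
  have dDv := ddif v hDs
  have qu : DifferentiableAt ℝ (fun y => dirDeriv u D y / D y) x := dDu.mul (dD.inv hDx0)
  have qv : DifferentiableAt ℝ (fun y => dirDeriv v D y / D y) x := dDv.mul (dD.inv hDx0)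
  have hφuu : dirDeriv u (dirDeriv u φ) x = _ := dirDeriv_congr hV'o hx' hφu
  have hφvv : dirDeriv v (dirDeriv v φ) x = _ := dirDeriv_congr hV'o hx' hφv
  rw [dirDeriv_sub qu (by fun_prop), dirDeriv_div dDu dD hDx0] at hφuu
  rw [dirDeriv_sub qv (by fun_prop), dirDeriv_div dDv dD hDx0] at hφvv
  simp (disch := fun_prop) only [dirDeriv_add, dirDeriv_mul, dirDeriv_const, zero_mul, zero_add]
    at hφuu hφvv
  have hDuu := dirDeriv_congr (u := u) hV hx (hD1 u)
  have hDvv := dirDeriv_congr (u := v) hV hx (hD1 v)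
  have heuu := dirDeriv_congr (u := u) hV hx heu
  have heuv := dirDeriv_congr (u := v) hV hx heu
  have hevu := dirDeriv_congr (u := u) hV hx hev
  have hevv := dirDeriv_congr (u := v) hV hx hev
  have hfuu := dirDeriv_congr (u := u) hV hx hfu
  have hfuv := dirDeriv_congr (u := v) hV hx hfu
  have hfvu := dirDeriv_congr (u := u) hV hx hfv
  have hfvv := dirDeriv_congr (u := v) hV hx hfv
  have hguu := dirDeriv_congr (u := u) hV hx hgu
  have hguv := dirDeriv_congr (u := v) hV hx hgu
  have hgvu := dirDeriv_congr (u := u) hV hx hgv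
  have hgvv := dirDeriv_congr (u := v) hV hx hgv
  have htuu := dirDeriv_congr (u := u) hV hx (htr1 u)
  have htuv := dirDeriv_congr (u := v) hV hx (htr1 u)
  have htvv := dirDeriv_congr (u := v) hV hx (htr1 v)
  have hMuu := dirDeriv_congr (u := u) hV hx hcL
  have hMuv := dirDeriv_congr (u := v) hV hx hcL
  have hMvu := dirDeriv_congr (u := u) hV hx hcN
  have hMvv := dirDeriv_congr (u := v) hV hx hcN
  simp (disch := fun_prop) only [dirDeriv_add, dirDeriv_sub, dirDeriv_mul, dirDeriv_const,
    zero_mul, zero_add] at hDuu hDvv heuu heuv hevu hevv hfuu hfuv hfvu hfvv hguu hguv hgvu hgvv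
  simp (disch := fun_prop) only [dirDeriv_add, dirDeriv_sub, dirDeriv_mul, dirDeriv_const,
    zero_mul, zero_add] at htuu htuv htvv hMuu hMuv hMvu hMvv
  -- Mixed derivatives of `L` and `M` are brought to one order, since `simons_jet` has a single
  -- variable for each.
  rw [dirDeriv_comm (hL x hx) (u := u) (v := v)] at hMuu
  rw [dirDeriv_comm (hM x hx) (u := u) (v := v)] at hMvu
  have htu := htr1 u x hx
  have htv := htr1 v x hx
  rw [hex, hfx, hgx] at htu htv htuu htuv htvv
  have hlu := hφu x hx'
  have hlv := hφv x hx'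
  refine sub_eq_zero.1 ((mul_eq_zero.1 (simons_jet (g1 := g₁ x) (g2 := g₂ x) (m1 := m₁ x)
    (m2 := m₂ x) (n1 := n₁ x) (n2 := n₂ x) (L := L x) (M := M x)
    (g1u := dirDeriv u g₁ x) (g1v := dirDeriv v g₁ x)
    (g2u := dirDeriv u g₂ x) (g2v := dirDeriv v g₂ x)
    (m1u := dirDeriv u m₁ x) (m1v := dirDeriv v m₁ x)
    (m2u := dirDeriv u m₂ x) (m2v := dirDeriv v m₂ x)
    (n1u := dirDeriv u n₁ x) (n1v := dirDeriv v n₁ x)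
    (n2u := dirDeriv u n₂ x) (n2v := dirDeriv v n₂ x)
    (heu x hx |>.trans ?_) (hev x hx |>.trans ?_) (hfu x hx |>.trans ?_) (hfv x hx |>.trans ?_)
    (hgu x hx |>.trans ?_) (hgv x hx |>.trans ?_)
    (heuu.trans ?_) (heuv.trans ?_) (hevu.trans ?_) (hevv.trans ?_) (dirDeriv_comm (he x hx))
    (hfuu.trans ?_) (hfuv.trans ?_) (hfvu.trans ?_) (hfvv.trans ?_) (dirDeriv_comm (hf x hx))
    (hguu.trans ?_) (hguv.trans ?_) (hgvu.trans ?_) (hgvv.trans ?_) (dirDeriv_comm (hg x hx))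
    hNx (Lu := dirDeriv u L x) (Lv := dirDeriv v L x) (Nu := dirDeriv u N x)
    (Nv := dirDeriv v N x) (by linear_combination htu) (by linear_combination htv)
    ((hcN x hx).trans ?_) ((hcL x hx).trans ?_)
    (Luu := dirDeriv u (dirDeriv u L) x) (Lvv := dirDeriv v (dirDeriv v L) x)
    (Luv := dirDeriv v (dirDeriv u L) x)
    (Nuu := dirDeriv u (dirDeriv u N) x) (Nvv := dirDeriv v (dirDeriv v N) x)
    (Nuv := dirDeriv v (dirDeriv u N) x)
    (by linear_combination htuu) (by linear_combination htvv) (by linear_combination htuv)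
    (hMuu.trans ?_) (hMuv.trans ?_) (hMvu.trans ?_) (hMvv.trans ?_)
    (hD1 u x hx |>.trans ?_) (hD1 v x hx |>.trans ?_) (hDuu.trans ?_) (hDvv.trans ?_)
    (Du := dirDeriv u D x) (Dv := dirDeriv v D x)
    (Duu := dirDeriv u (dirDeriv u D) x) (Dvv := dirDeriv v (dirDeriv v D) x)
    (lu := dirDeriv u φ x) (lv := dirDeriv v φ x)
    (luu := dirDeriv u (dirDeriv u φ) x) (lvv := dirDeriv v (dirDeriv v φ) x)
    (by rw [hlu, ← hDx, sub_mul, div_mul_cancel₀ _ hDx0])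
    (by rw [hlv, ← hDx, sub_mul, div_mul_cancel₀ _ hDx0])
    (by rw [hφuu, ← hDx, sub_mul, div_mul_cancel₀ _ (pow_ne_zero 2 hDx0)]; ring)
    (by rw [hφvv, ← hDx, sub_mul, div_mul_cancel₀ _ (pow_ne_zero 2 hDx0)]; ring)
    (K := dirDeriv u n₁ x - dirDeriv v m₁ x + (n₁ x * g₁ x + n₂ x * m₁ x)
        - (m₁ x * m₁ x + m₂ x * n₁ x)) rfl)).resolve_right (by rw [← hDx]; positivity))
  all_goals try simp only [hex, hfx, hgx]
  all_goals ring

end functions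

end LocalGeometry

namespace LocalGeometry

/-! ### Minimal surfaces in a coordinate domain of hyperbolic space -/

variable {m n : ℕ}

theorem IsImmersionOn.mono {F : E m → E n} {V V' : Set (E m)} {U : Set (E n)}
    (I : IsImmersionOn F V U) (hV' : IsOpen V') (h : V' ⊆ V) : IsImmersionOn F V' U where
  isOpen := hV'
  smooth y hy := I.smooth y (h hy)
  mapsTo := I.mapsTo.mono_left h
  injective y hy := I.injective y (h hy)

theorem contDiffAt_tangentPart {G : E n → E n →L[ℝ] E n →L[ℝ] ℝ} {U : Set (E n)}
    {F : E m → E n} {V : Set (E m)} (H : IsMetricOn G U) (I : IsImmersionOn F V U)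
    {y : E m} (hy : y ∈ V) (w : E n) : ContDiffAt ℝ ∞ (fun y => tangentPart G F y w) y := by
  have hP := H.pullback I
  refine contDiffAt_riesz (hP.smooth y hy) (hP.inner y hy) fun z => ?_
  exact (((H.smooth _ (I.mapsTo hy)).comp y (I.smooth y hy)).clm_apply contDiffAt_const).clm_apply
    ((I.smooth y hy).fderiv_infty.clm_apply contDiffAt_const)

/-- By dimension count the image of `T` and `N` span the space. The difference $w-\langle w,N\rangle
N$ is orthogonal to both, hence to itself. -/
theorem IsInner.eq_smul_of_orth {b : E (m + 1) →L[ℝ] E (m + 1) →L[ℝ] ℝ} (hb : IsInner b)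
    {T : E m →L[ℝ] E (m + 1)} (hT : Function.Injective T) {N w : E (m + 1)}
    (ho : ∀ z, b N (T z) = 0) (hu : b N N = 1) (hw : ∀ z, b w (T z) = 0) : w = b w N • N := by
  let L : E m × ℝ →ₗ[ℝ] E (m + 1) :=
    (T : E m →ₗ[ℝ] E (m + 1)).coprod (LinearMap.toSpanSingleton ℝ _ N)
  have hL : ∀ z t, L (z, t) = T z + t • N := fun z t => by simp [L]
  have hinj : Function.Injective L := by
    rw [← LinearMap.ker_eq_bot, LinearMap.ker_eq_bot']
    rintro ⟨z, t⟩ h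
    rw [hL] at h
    have ht : t = 0 := by
      have := congrArg (b N) h
      simpa [ho, hu] using this
    subst ht
    rw [zero_smul, add_zero] at h
    rw [hT (h.trans (map_zero T).symm)]
    rfl
  have hsurj := (LinearMap.injective_iff_surjective_of_finrank_eq_finrank (f := L) (by simp)).1 hinj
  obtain ⟨⟨z, t⟩, h⟩ := hsurj (w - b w N • N)
  rw [hL] at h
  rw [← sub_eq_zero]
  by_contra hne
  have hp := hb.pos _ hne
  have h1 : ∀ z, b (w - b w N • N) (T z) = 0 := fun z => by simp [hw, ho]
  have h2 : b (w - b w N • N) N = 0 := by simp [hu]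
  rw [congrArg (b (w - b w N • N)) h.symm, map_add, map_smul, h1, h2] at hp
  simp at hp

/-- Locally, a hypersurface has a smooth unit normal field. -/
theorem exists_isUnitNormal {G : E (m + 1) → E (m + 1) →L[ℝ] E (m + 1) →L[ℝ] ℝ}
    {U : Set (E (m + 1))} {F : E m → E (m + 1)} {V : Set (E m)} (H : IsMetricOn G U)
    (I : IsImmersionOn F V U) {x : E m} (hx : x ∈ V) :
    ∃ V' ⊆ V, IsOpen V' ∧ x ∈ V' ∧ ∃ N, IsUnitNormal G F V' N := by
  -- A vector outside the tangent plane at `x` exists for dimension reasons. Its normal part is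
  -- nonzero at `x`, hence nearby, and is then normalized.
  obtain ⟨n₀, hn₀⟩ : ∃ n₀, ∀ z, fderiv ℝ F x z ≠ n₀ := by
    by_contra! hcon
    have hsurj : Function.Surjective (fderiv ℝ F x : E m →ₗ[ℝ] E (m + 1)) := hcon
    have := LinearMap.finrank_le_finrank_of_surjective hsurj
    simp at this
  let N₀ : E m → E (m + 1) := fun y => n₀ - fderiv ℝ F y (tangentPart G F y n₀)
  have hN₀ : ∀ y ∈ V, ContDiffAt ℝ ∞ N₀ y := fun y hy =>
    contDiffAt_const.sub ((I.smooth y hy).fderiv_infty.clm_apply (contDiffAt_tangentPart H I hy n₀))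
  have hN₀x : N₀ x ≠ 0 := fun h => hn₀ _ (sub_eq_zero.1 h).symm
  have horth : ∀ y ∈ V, ∀ z, G (F y) (N₀ y) (fderiv ℝ F y z) = 0 := fun y hy z => by
    have := H.normalPart_orth I hy n₀ z
    rwa [H.normalPart_eq I hy] at this
  have hc : ContinuousOn N₀ V := fun y hy => (hN₀ y hy).continuousAt.continuousWithinAt
  refine ⟨V ∩ {y | N₀ y ≠ 0}, Set.inter_subset_left, hc.isOpen_inter_preimage I.isOpen isOpen_ne,
    ⟨hx, hN₀x⟩, fun y => (√(G (F y) (N₀ y) (N₀ y)))⁻¹ • N₀ y, ?_⟩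
  have hpos : ∀ y ∈ V ∩ {y | N₀ y ≠ 0}, 0 < G (F y) (N₀ y) (N₀ y) := fun y hy =>
    (H.inner _ (I.mapsTo hy.1)).pos _ hy.2
  have horth' : ∀ y ∈ V ∩ {y | N₀ y ≠ 0}, ∀ z, G (F y) ((√(G (F y) (N₀ y) (N₀ y)))⁻¹ • N₀ y)
      (fderiv ℝ F y z) = 0 := fun y hy z => by
    simp [horth y hy.1 z]
  have hunit : ∀ y ∈ V ∩ {y | N₀ y ≠ 0}, G (F y) ((√(G (F y) (N₀ y) (N₀ y)))⁻¹ • N₀ y)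
      ((√(G (F y) (N₀ y) (N₀ y)))⁻¹ • N₀ y) = 1 := fun y hy => by
    have h := hpos y hy
    simp only [map_smul, smul_apply, smul_eq_mul]
    rw [← mul_assoc, ← mul_inv, Real.mul_self_sqrt h.le, inv_mul_cancel₀ h.ne']
  refine ⟨fun y hy => ?_, horth', hunit, fun y hy w hw => ?_⟩
  · have hq : ContDiffAt ℝ ∞ (fun y => G (F y) (N₀ y) (N₀ y)) y :=
      (((H.smooth _ (I.mapsTo hy.1)).comp y (I.smooth y hy.1)).clm_apply (hN₀ y hy.1)).clm_apply
        (hN₀ y hy.1)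
    exact ((hq.sqrt (hpos y hy).ne').inv (Real.sqrt_ne_zero'.2 (hpos y hy))).smul (hN₀ y hy.1)
  · exact (H.inner _ (I.mapsTo hy.1)).eq_smul_of_orth (I.injective y hy.1) (horth' y hy)
      (hunit y hy) hw

theorem IsInner.det_pos {b : E n →L[ℝ] E n →L[ℝ] ℝ} (hb : IsInner b) {u v : E n}
    (huv : LinearIndependent ℝ ![u, v]) : 0 < b u u * b v v - b u v * b u v := by
  have hv : v ≠ 0 := huv.ne_zero 1
  have hvv := hb.pos v hv
  have hz : b v v • u - b u v • v ≠ 0 := by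
    intro h
    have := LinearIndependent.pair_iff.1 huv (b v v) (-b u v) (by rw [← h]; module)
    exact hvv.ne' this.1
  have hp := hb.pos _ hz
  simp only [map_sub, map_smul, sub_apply, smul_apply, smul_eq_mul, hb.symm v u] at hp
  have : 0 < b v v * (b u u * b v v - b u v * b u v) := by nlinarith
  exact pos_of_mul_pos_right this hvv.le

theorem gramInv_two (b : E 2 →L[ℝ] E 2 →L[ℝ] ℝ) (hb : IsInner b) :
    gramInv b 0 0 = b (stdVec 1) (stdVec 1) / (b (stdVec 0) (stdVec 0) * b (stdVec 1) (stdVec 1)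
        - b (stdVec 0) (stdVec 1) * b (stdVec 0) (stdVec 1)) ∧
    gramInv b 0 1 = -b (stdVec 0) (stdVec 1) / (b (stdVec 0) (stdVec 0) * b (stdVec 1) (stdVec 1)
        - b (stdVec 0) (stdVec 1) * b (stdVec 0) (stdVec 1)) ∧
    gramInv b 1 0 = -b (stdVec 0) (stdVec 1) / (b (stdVec 0) (stdVec 0) * b (stdVec 1) (stdVec 1)
        - b (stdVec 0) (stdVec 1) * b (stdVec 0) (stdVec 1)) ∧
    gramInv b 1 1 = b (stdVec 0) (stdVec 0) / (b (stdVec 0) (stdVec 0) * b (stdVec 1) (stdVec 1)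
        - b (stdVec 0) (stdVec 1) * b (stdVec 0) (stdVec 1)) := by
  simp only [gramInv, Matrix.inv_def, Matrix.det_fin_two, Matrix.adjugate_fin_two,
    Ring.inverse_eq_inv', Matrix.smul_apply, Matrix.of_apply, smul_eq_mul, Matrix.cons_val',
    Matrix.cons_val_zero, Matrix.cons_val_one, Matrix.cons_val_fin_one,
    hb.symm (stdVec 1) (stdVec 0)]
  refine ⟨?_, ?_, ?_, ?_⟩ <;> rw [div_eq_inv_mul]

theorem linearIndependent_stdVec : LinearIndependent ℝ ![(stdVec 0 : E 2), stdVec 1] := by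
  refine LinearIndependent.pair_iff.2 fun s t h => ?_
  have h0 := congrArg (fun z : E 2 => z 0) h
  have h1 := congrArg (fun z : E 2 => z 1) h
  simp [stdVec_apply] at h0 h1
  exact ⟨h0, h1⟩

theorem IsInner.exists_orthonormal {b : E 2 →L[ℝ] E 2 →L[ℝ] ℝ} (hb : IsInner b) :
    ∃ u v, b u u = 1 ∧ b u v = 0 ∧ b v v = 1 := by
  have normalise : ∀ w, w ≠ 0 → b ((√(b w w))⁻¹ • w) ((√(b w w))⁻¹ • w) = 1 := fun w hw => by
    have h := hb.pos w hw
    simp only [map_smul, smul_apply, smul_eq_mul]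
    rw [← mul_assoc, ← mul_inv, Real.mul_self_sqrt h.le, inv_mul_cancel₀ h.ne']
  have h0 : (stdVec 0 : E 2) ≠ 0 := linearIndependent_stdVec.ne_zero 0
  set r := (√(b (stdVec 0) (stdVec 0)))⁻¹
  have hu := normalise _ h0
  set u : E 2 := r • stdVec 0 with hu'
  -- As `u` is a multiple of `stdVec 0`, the second coordinate of this vector is $1$.
  have hv : stdVec 1 - b u (stdVec 1) • u ≠ 0 := fun h => by
    have h1 := congrArg (fun z : E 2 => z 1) h
    simp [stdVec_apply, hu'] at h1
  refine ⟨u, _, hu, ?_, normalise _ hv⟩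
  simp [hu]

theorem IsInner.linearIndependent {b : E n →L[ℝ] E n →L[ℝ] ℝ} (hb : IsInner b) {u v : E n}
    (hu : b u u = 1) (huv : b u v = 0) (hv : b v v = 1) : LinearIndependent ℝ ![u, v] := by
  refine LinearIndependent.pair_iff.2 fun s t h => ?_
  have h1 := congrArg (fun z => b z u) h
  have h2 := congrArg (fun z => b z v) h
  simp [hu, hv, huv, hb.symm v u] at h1 h2
  exact ⟨h1, h2⟩

theorem IsInner.expand {b : E 2 →L[ℝ] E 2 →L[ℝ] ℝ} (hb : IsInner b) {u v : E 2}
    (hu : b u u = 1) (huv : b u v = 0) (hv : b v v = 1) (w : E 2) :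
    w = b w u • u + b w v • v := by
  have hli := hb.linearIndependent hu huv hv
  have hsp := hli.span_eq_top_of_card_eq_finrank (by simp)
  have hw : w ∈ Submodule.span ℝ (Set.range ![u, v]) := hsp ▸ Submodule.mem_top
  simp only [Matrix.range_cons, Matrix.range_empty, Set.union_empty, Set.singleton_union] at hw
  obtain ⟨s, t, rfl⟩ := Submodule.mem_span_pair.1 hw
  simp [hu, hv, huv, hb.symm v u]

/-- The trace of a bilinear form in an orthonormal basis. -/
theorem IsInner.trace_eq {b : E 2 →L[ℝ] E 2 →L[ℝ] ℝ} (hb : IsInner b) {u v : E 2}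
    (hu : b u u = 1) (huv : b u v = 0) (hv : b v v = 1) (B : E 2 →ₗ[ℝ] E 2 →ₗ[ℝ] ℝ) :
    ∑ i, ∑ j, gramInv b i j * B (stdVec i) (stdVec j) = B u u + B v v := by
  have h := sum_gram_inv_smul b ![u, v] (hb.linearIndependent hu huv hv) B
  have hg : gram b ![u, v] = 1 := by
    ext i j
    fin_cases i <;> fin_cases j <;> simp [gram, hu, huv, hv, hb.symm v u]
  rw [hg, inv_one] at h
  simp only [smul_eq_mul] at h
  rw [← h]
  simp [Fin.sum_univ_two]

/-- The squared norm of the second fundamental form of a parametrized submanifold. -/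
def secondFormNormSq (G : E n → E n →L[ℝ] E n →L[ℝ] ℝ) (F : E m → E n) (x : E m) : ℝ :=
  ∑ i, ∑ j, ∑ k, ∑ l, gramInv (pullback G F x) i k * gramInv (pullback G F x) j l *
    G (F x) (secondForm G F x (stdVec i) (stdVec j)) (secondForm G F x (stdVec k) (stdVec l))

section surface

variable {G : E n → E n →L[ℝ] E n →L[ℝ] ℝ} {U : Set (E n)} {F N : E m → E n} {V : Set (E m)}

theorem scalarForm_symm (H : IsMetricOn G U) (I : IsImmersionOn F V U) {y : E m} (hy : y ∈ V)
    (u v : E m) : scalarForm G F N y u v = scalarForm G F N y v u := by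
  rw [scalarForm, scalarForm, H.secondForm_symm I hy]

theorem scalarForm_combo (H : IsMetricOn G U) (I : IsImmersionOn F V U) {y : E m} (hy : y ∈ V)
    (a c : ℝ) (u v w : E m) : scalarForm G F N y u (a • v + c • w)
      = a * scalarForm G F N y u v + c * scalarForm G F N y u w := by
  simp only [scalarForm, H.secondForm_eq_normalPart I hy, map_add, map_smul, map_sub, add_apply,
    sub_apply, smul_apply, smul_eq_mul]
  ring

end surface

/-- `b` applied to a trace-free form, in coordinates of the plane. -/
theorem trace_free_two {b : E 2 →L[ℝ] E 2 →L[ℝ] ℝ} (hb : IsInner b) {q : E 2 → E 2 → ℝ}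
    (hq : ∀ v w, q v w = q w v)
    (hl : ∀ (a c : ℝ) u v w, q u (a • v + c • w) = a * q u v + c * q u w)
    (h0 : ∑ i, ∑ j, gramInv b i j * q (stdVec i) (stdVec j) = 0) {u v : E 2}
    (huv : LinearIndependent ℝ ![u, v]) :
    (b u u * q v v - 2 * (b u v * q u v)) + b v v * q u u = 0 ∧
    ∑ i, ∑ j, ∑ k, ∑ l, gramInv b i k * gramInv b j l *
        (q (stdVec i) (stdVec j) * q (stdVec k) (stdVec l))
      = 2 * ((q u v * q u v - q u u * q v v) / (b u u * b v v - b u v * b u v)) := by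
  obtain ⟨h1, h2, h3, h4⟩ := gramInv_two b hb
  have hW := (hb.det_pos linearIndependent_stdVec).ne'
  have hW' := (hb.det_pos huv).ne'
  have hu := sum_smul_stdVec u
  have hv := sum_smul_stdVec v
  rw [Fin.sum_univ_two] at hu hv
  generalize u 0 = u₀, u 1 = u₁ at hu
  generalize v 0 = v₀, v 1 = v₁ at hv
  have hl' : ∀ (a c : ℝ) u v w, q (a • v + c • w) u = a * q v u + c * q w u := fun a c u v w => by
    rw [hq, hl, hq u, hq u]
  have hbl : ∀ (a c : ℝ) u v w, b u (a • v + c • w) = a * b u v + c * b u w :=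
    fun a c u v w => by simp
  have hbl' : ∀ (a c : ℝ) u v w, b (a • v + c • w) u = a * b v u + c * b w u :=
    fun a c u v w => by simp
  simp only [Fin.sum_univ_two, h1, h2, h3, h4] at h0 ⊢
  subst hu hv
  simp only [hl, hl', hbl, hbl', hq (stdVec 1) (stdVec 0), hb.symm (stdVec 1) (stdVec 0)]
    at h0 hW' ⊢
  generalize b (stdVec 0) (stdVec 0) = e, b (stdVec 0) (stdVec 1) = f,
    b (stdVec 1) (stdVec 1) = g at *
  generalize q (stdVec 0) (stdVec 0) = L, q (stdVec 0) (stdVec 1) = M,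
    q (stdVec 1) (stdVec 1) = N at *
  simp only [div_eq_mul_inv _ (e * g - f * f)] at h0 ⊢
  have hr : (e * g - f * f) * (e * g - f * f)⁻¹ = 1 := mul_inv_cancel₀ hW
  have h00 : e * N - 2 * f * M + g * L = 0 := by
    linear_combination (e * g - f * f) * h0 - (e * N - 2 * f * M + g * L) * hr
  -- Passing to the frame `(u, v)` multiplies the determinants of `b` and of `q` by the same factor,
  -- the squared determinant of the change of basis, so their ratio is unchanged.
  have hd : (u₀ * v₁ - u₁ * v₀) ^ 2 * (e * g - f * f) ≠ 0 := fun h => hW' (by rw [← h]; ring)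
  have hd' : (u₀ * v₁ - u₁ * v₀) ^ 2 ≠ 0 := left_ne_zero_of_mul hd
  refine ⟨by linear_combination (u₀ * v₁ - u₁ * v₀) ^ 2 * h00, ?_⟩
  have hq : ∀ A B, A = (u₀ * v₁ - u₁ * v₀) ^ 2 * (M * M - L * N) →
      B = (u₀ * v₁ - u₁ * v₀) ^ 2 * (e * g - f * f) →
      A / B = (M * M - L * N) * (e * g - f * f)⁻¹ := by
    rintro A B rfl rfl
    rw [mul_div_mul_left _ _ hd', div_eq_mul_inv]
  rw [hq _ _ (by ring) (by ring)]
  generalize (e * g - f * f)⁻¹ = r at hr ⊢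
  -- This is $\|q\|^2=(\operatorname{tr}q)^2-2\det q/\det b$, with the trace equal to
  -- $r(eN-2fM+gL)=0$.
  linear_combination r ^ 2 * (e * N - 2 * f * M + g * L) * h00 + 2 * (M * M - L * N) * r * hr

end LocalGeometry

/-! ### Simons' identity and the Gauss equation for surfaces in coordinates. -/

namespace LocalGeometry

variable {G : E 3 → E 3 →L[ℝ] E 3 →L[ℝ] ℝ} {U : Set (E 3)} {F N : E 2 → E 3} {V : Set (E 2)}

/-- The Hessian of `φ`, as a bilinear map. -/
def hessian {n : ℕ} (h : E n → E n →L[ℝ] E n →L[ℝ] ℝ) (φ : E n → ℝ) (x : E n) :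
    E n →ₗ[ℝ] E n →ₗ[ℝ] ℝ :=
  LinearMap.mk₂ ℝ (fun a c => fderiv ℝ (fderiv ℝ φ) x a c - fderiv ℝ φ x (chr h x a c))
    (fun a a' c => by simp; ring) (fun r a c => by simp; ring)
    (fun a c c' => by simp; ring) (fun r a c => by simp; ring)

theorem laplace_eq {h : E 2 → E 2 →L[ℝ] E 2 →L[ℝ] ℝ} {x : E 2} (hi : IsInner (h x)) {u v : E 2}
    (hu : h x u u = 1) (huv : h x u v = 0) (hv : h x v v = 1) (φ : E 2 → ℝ) :
    laplace h φ x = (fderiv ℝ (fderiv ℝ φ) x u u - fderiv ℝ φ x (christoffel h x u u))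
      + (fderiv ℝ (fderiv ℝ φ) x v v - fderiv ℝ φ x (christoffel h x v v)) :=
  hi.trace_eq hu huv hv (hessian h φ x)

/-- Simons' identity: `Δ log ‖A‖² = 4K` for a trace-free Codazzi tensor `A` on a surface. -/
theorem laplace_log_codazzi {h : E 2 → E 2 →L[ℝ] E 2 →L[ℝ] ℝ} {V : Set (E 2)}
    (H : IsMetricOn h V) {q : E 2 → E 2 → E 2 → ℝ}
    (hsmooth : ∀ u v, ∀ y ∈ V, ContDiffAt ℝ ∞ (fun y => q y u v) y)
    (hsymm : ∀ y ∈ V, ∀ u v, q y u v = q y v u)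
    (hlin : ∀ y ∈ V, ∀ (a c : ℝ) u v w, q y u (a • v + c • w) = a * q y u v + c * q y u w)
    (hcod : ∀ y ∈ V, ∀ u v, fderiv ℝ (fun y => q y v v) y u - fderiv ℝ (fun y => q y u v) y v
        = q y v (christoffel h y u v) - q y u (christoffel h y v v))
    (htr : ∀ y ∈ V, ∑ i, ∑ j, gramInv (h y) i j * q y (stdVec i) (stdVec j) = 0)
    {x : E 2} (hx : x ∈ V) {u v : E 2} (hu : h x u u = 1) (huv : h x u v = 0) (hv : h x v v = 1)
    (hD : q x u v ^ 2 - q x u u * q x v v ≠ 0) {φ : E 2 → ℝ}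
    (hφs : ContDiffAt ℝ ∞ φ x)
    (hφ : ∀ y ∈ V, φ y = Real.log (2 * ((q y u v * q y u v - q y u u * q y v v)
      / (h y u u * h y v v - h y u v * h y u v)))) :
    laplace h φ x = 4 * h x (curvature h x u v v) u := by
  have hi := H.inner x hx
  have hli := hi.linearIndependent hu huv hv
  have hs : ∀ a b, ∀ y ∈ V, ContDiffAt ℝ ∞ (fun y => h y a b) y := fun a b y hy =>
    ((H.smooth y hy).clm_apply contDiffAt_const).clm_apply contDiffAt_const
  have hc : ∀ a b, DifferentiableAt ℝ (fun y => christoffel h y a b) x := fun a b =>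
    (((contDiffAt_chr (H.smooth x hx) hi).clm_apply contDiffAt_const).clm_apply
      contDiffAt_const).differentiableAt (by simp)
  have hcc : ∀ a b c, DifferentiableAt ℝ (fun y => h x (christoffel h y a b) c) x := fun a b c =>
    (((h x).flip c).differentiableAt).comp x (hc a b)
  have hcd : ∀ a b c w, dirDeriv w (fun y => h x (christoffel h y a b) c) x
      = h x (fderiv ℝ (fun y => christoffel h y a b) x w) c := fun a b c w => by
    have := (((h x).flip c).hasFDerivAt.comp x (hc a b).hasFDerivAt).fderiv
    rw [dirDeriv]
    erw [this]
    rfl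
  -- The Christoffel vectors at all points `y` are expanded in the fixed frame `(u, v)`. The
  -- coefficients are read off with the metric frozen at `x`, where this frame is orthonormal.
  have ex : ∀ y a b, christoffel h y a b = h x (christoffel h y a b) u • u
      + h x (christoffel h y a b) v • v := fun y a b => hi.expand hu huv hv _
  have dmet : ∀ w a b, ∀ y ∈ V, dirDeriv w (fun y => h y a b) y
      = h y (christoffel h y w a) b + h y a (christoffel h y w b) := fun w a b y hy => by
    have hd := (H.smooth y hy).differentiableAt (by simp)
    rw [← H.fderiv_metric hy, dirDeriv,
      fderiv_apply_const (hd.clm_apply (differentiableAt_const a)), fderiv_apply_const hd]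
  have hl1 : ∀ y (a c : ℝ) (p r w : E 2), h y (a • p + c • r) w = a * h y p w + c * h y r w :=
    fun y a c p r w => by simp
  have hl2 : ∀ y (a c : ℝ) (p r w : E 2), h y w (a • p + c • r) = a * h y w p + c * h y w r :=
    fun y a c p r w => by simp
  have key := simons_components (x := x) (u := u) (v := v) H.isOpen hx
    (e := fun y => h y u u) (f := fun y => h y u v) (g := fun y => h y v v)
    (L := fun y => q y u u) (M := fun y => q y u v) (N := fun y => q y v v)
    (g₁ := fun y => h x (christoffel h y u u) u) (g₂ := fun y => h x (christoffel h y u u) v)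
    (m₁ := fun y => h x (christoffel h y u v) u) (m₂ := fun y => h x (christoffel h y u v) v)
    (n₁ := fun y => h x (christoffel h y v v) u) (n₂ := fun y => h x (christoffel h y v v) v)
    (hs _ _) (hs _ _) (hs _ _) (hsmooth _ _) (hsmooth _ _) (hsmooth _ _)
    (hcc _ _ _) (hcc _ _ _) (hcc _ _ _) (hcc _ _ _) (hcc _ _ _) (hcc _ _ _)
    (fun y hy => by
      rw [dmet _ _ _ y hy, (H.inner y hy).symm u (christoffel h y u u)]
      conv_lhs => rw [ex y u u, hl1, (H.inner y hy).symm v u]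
      ring)
    (fun y hy => by
      rw [dmet _ _ _ y hy, H.christoffel_symm hy v u, (H.inner y hy).symm u (christoffel h y u v)]
      conv_lhs => rw [ex y u v, hl1, (H.inner y hy).symm v u]
      ring)
    (fun y hy => by
      rw [dmet _ _ _ y hy]
      conv_lhs => rw [ex y u v, ex y u u, hl1, hl2])
    (fun y hy => by
      rw [dmet _ _ _ y hy, H.christoffel_symm hy v u]
      conv_lhs => rw [ex y u v, ex y v v, hl1, hl2])
    (fun y hy => by
      rw [dmet _ _ _ y hy, (H.inner y hy).symm v (christoffel h y u v)]
      conv_lhs => rw [ex y u v, hl1]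
      ring)
    (fun y hy => by
      rw [dmet _ _ _ y hy, (H.inner y hy).symm v (christoffel h y v v)]
      conv_lhs => rw [ex y v v, hl1]
      ring)
    (fun y hy => (trace_free_two (H.inner y hy) (hsymm y hy) (hlin y hy) (htr y hy) hli).1)
    (fun y hy => by
      have h1 := hcod y hy u v
      rw [ex y u v, ex y v v, hlin y hy, hlin y hy, hsymm y hy v u] at h1
      simp only [dirDeriv]
      linarith)
    -- The second component of the Codazzi equation is the first with `u` and `v` exchanged, after
    -- replacing `q y v u` by `q y u v` under the derivative.
    (fun y hy => by
      have h1 := hcod y hy v u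
      have h2 : fderiv ℝ (fun y => q y v u) y = fderiv ℝ (fun y => q y u v) y := by
        refine Filter.EventuallyEq.fderiv_eq ?_
        filter_upwards [H.mem_nhds hy] with z hz using hsymm z hz v u
      rw [h2, H.christoffel_symm hy v u, ex y u v, ex y u u, hlin y hy, hlin y hy,
        hsymm y hy v u] at h1
      simp only [dirDeriv]
      linarith)
    hu huv hv hD (fun y hy => ((H.inner y hy).det_pos hli).ne') hφ
  have hcl : ∀ a b, fderiv ℝ φ x (christoffel h x a b)
      = h x (christoffel h x a b) u * dirDeriv u φ x
        + h x (christoffel h x a b) v * dirDeriv v φ x := by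
    intro a b
    conv_lhs => rw [ex x a b]
    simp [dirDeriv]
  rw [laplace_eq hi hu huv hv, hcl, hcl, ← dirDeriv_dirDeriv hφs, ← dirDeriv_dirDeriv hφs]
  rw [hcd, hcd] at key
  have hcurv : h x (curvature h x u v v) u = h x (fderiv ℝ (fun y => christoffel h y v v) x u) u
      - h x (fderiv ℝ (fun y => christoffel h y u v) x v) u
      + (h x (christoffel h x v v) u * h x (christoffel h x u u) u
        + h x (christoffel h x v v) v * h x (christoffel h x u v) u)
      - (h x (christoffel h x u v) u * h x (christoffel h x u v) u
        + h x (christoffel h x u v) v * h x (christoffel h x v v) u) := by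
    have h1 : ∀ p a b, christoffel h x p (christoffel h x a b)
        = h x (christoffel h x a b) u • christoffel h x p u
          + h x (christoffel h x a b) v • christoffel h x p v := by
      intro p a b
      conv_lhs => rw [ex x a b, ← chr_apply, map_add, map_smul, map_smul]
      rfl
    rw [curvature, h1, h1, H.christoffel_symm hx v u]
    simp only [map_add, map_sub, map_smul, add_apply, sub_apply, smul_apply, smul_eq_mul]
  rw [hcurv]
  linear_combination key

/-- Simons' identity and the Gauss equation for minimal surfaces in hyperbolic space, in
coordinates. -/
theorem laplace_log_secondFormNormSq (H : IsMetricOn G U) (I : IsImmersionOn F V U)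
    (hs : ∀ y ∈ U, ∀ u v, LinearIndependent ℝ ![u, v] → sectional G y u v = -1)
    (hmin : ∀ y ∈ V, ∑ i, ∑ j, gramInv (pullback G F y) i j
      • secondForm G F y (stdVec i) (stdVec j) = 0)
    {x : E 2} (hx : x ∈ V) (hne : secondFormNormSq G F x ≠ 0) :
    ContDiffAt ℝ ∞ (fun y => Real.log (secondFormNormSq G F y)) x ∧
    laplace (pullback G F) (fun y => Real.log (secondFormNormSq G F y)) x
      = 4 * sectional (pullback G F) x (stdVec 0) (stdVec 1) ∧
    4 * sectional (pullback G F) x (stdVec 0) (stdVec 1) = -2 * (2 + secondFormNormSq G F x) := by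
  obtain ⟨V', hV'V, hV', hx', N, K⟩ := exists_isUnitNormal H I hx
  have I' := I.mono hV' hV'V
  have hP := H.pullback I'
  obtain ⟨u, v, hu, huv, hv⟩ := (hP.inner x hx').exists_orthonormal
  have hli := (hP.inner x hx').linearIndependent hu huv hv
  have htr : ∀ y ∈ V', ∑ i, ∑ j, gramInv (pullback G F y) i j
      * scalarForm G F N y (stdVec i) (stdVec j) = 0 := fun y hy => by
    have := congrArg (fun w => G (F y) w (N y)) (hmin y (hV'V hy))
    simpa only [map_sum, map_smul, sum_apply, smul_apply, smul_eq_mul, map_zero, zero_apply,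
      scalarForm] using this
  have hsq : ∀ y ∈ V', ∀ {u v}, LinearIndependent ℝ ![u, v] → secondFormNormSq G F y
      = 2 * ((scalarForm G F N y u v * scalarForm G F N y u v
        - scalarForm G F N y u u * scalarForm G F N y v v)
        / (pullback G F y u u * pullback G F y v v - pullback G F y u v * pullback G F y u v)) := by
    intro y hy u v hli
    rw [secondFormNormSq, ← (trace_free_two (hP.inner y hy) (scalarForm_symm H I' hy)
      (scalarForm_combo H I' hy) (htr y hy) hli).2]
    simp only [K.inner_secondForm H I' hy]
  -- The Gauss equation gives $-1+\det a/\det h$, and $\det a/\det h=-\|A\|^2/2$ by `hsq`. Stating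
  -- it for every basis makes the sectional curvature independent of the basis, which `hcurv` uses.
  have hgauss : ∀ {u v}, LinearIndependent ℝ ![u, v] →
      sectional (pullback G F) x u v = -1 - secondFormNormSq G F x / 2 := by
    intro u v hli
    have hW := ((hP.inner x hx').det_pos hli).ne'
    rw [sectional, H.gauss I' hx', H.curvature_of_sectional (I'.mapsTo hx') (hs _ (I'.mapsTo hx')),
      K.inner_secondForm H I' hx', K.inner_secondForm H I' hx', hsq x hx' hli]
    rw [← pullback_apply, ← pullback_apply, ← pullback_apply, sq, scalarForm_symm H I' hx' v u,
      div_eq_iff hW]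
    linear_combination div_mul_cancel₀ (scalarForm G F N x u v * scalarForm G F N x u v
      - scalarForm G F N x u u * scalarForm G F N x v v) hW
  have hcurv : pullback G F x (curvature (pullback G F) x u v v) u
      = sectional (pullback G F) x (stdVec 0) (stdVec 1) := by
    rw [hgauss linearIndependent_stdVec, ← hgauss hli, sectional, hu, huv, hv]
    norm_num
  have hlog : ContDiffAt ℝ ∞ (fun y => Real.log (secondFormNormSq G F y)) x := by
    refine ContDiffAt.log ?_ hne
    have hb : ∀ a c, ContDiffAt ℝ ∞ (fun y => scalarForm G F N y a c) x := fun a c =>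
      K.contDiffAt_scalarForm H I' hx' a c
    have hh : ∀ a c, ContDiffAt ℝ ∞ (fun y => pullback G F y a c) x := fun a c =>
      ((hP.smooth x hx').clm_apply contDiffAt_const).clm_apply contDiffAt_const
    refine ContDiffAt.congr_of_eventuallyEq (f := fun y => 2 *
      ((scalarForm G F N y u v * scalarForm G F N y u v
        - scalarForm G F N y u u * scalarForm G F N y v v)
        / (pullback G F y u u * pullback G F y v v - pullback G F y u v * pullback G F y u v)))
      (contDiffAt_const.mul (ContDiffAt.div (((hb _ _).mul (hb _ _)).sub ((hb _ _).mul (hb _ _)))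
      (((hh _ _).mul (hh _ _)).sub ((hh _ _).mul (hh _ _)))
      ((hP.inner x hx').det_pos hli).ne')) ?_
    filter_upwards [hV'.mem_nhds hx'] with y hy using hsq y hy hli
  refine ⟨hlog, ?_, ?_⟩
  · rw [← hcurv]
    refine laplace_log_codazzi hP (q := scalarForm G F N)
      (fun u v y hy => K.contDiffAt_scalarForm H I' hy u v)
      (fun y hy => scalarForm_symm H I' hy) (fun y hy => scalarForm_combo H I' hy)
      (fun y hy => K.codazzi H I' hy (hs _ (I'.mapsTo hy))) htr hx' hu huv hv ?_ hlog
      (fun y hy => by rw [hsq y hy hli])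
    intro h0
    rw [hsq x hx' hli, ← sq, h0] at hne
    simp at hne
  · rw [hgauss linearIndependent_stdVec]
    ring

end LocalGeometry

namespace LocalGeometry

/-! ### Invariance of the norm of the second fundamental form under coordinate changes -/

variable {m n : ℕ} {G : E n → E n →L[ℝ] E n →L[ℝ] ℝ} {U U' : Set (E n)}
  {F : E m → E n} {V V' : Set (E m)} {φ : E m → E m} {ψ : E n → E n}

/-- The differential of `φ` carries the standard basis to a basis whose Gram matrix is that of the
pulled-back metric, so `sum_gram_inv_smul` applies. -/
theorem sum_gramInv_pullback {X : Type*} [AddCommGroup X] [Module ℝ X]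
    (h : E m → E m →L[ℝ] E m →L[ℝ] ℝ) (J : IsImmersionOn φ V V') {x : E m} (hx : x ∈ V)
    (B : E m →ₗ[ℝ] E m →ₗ[ℝ] X) :
    ∑ i, ∑ j, gramInv (pullback h φ x) i j
        • B (fderiv ℝ φ x (stdVec i)) (fderiv ℝ φ x (stdVec j))
      = ∑ i, ∑ j, gramInv (h (φ x)) i j • B (stdVec i) (stdVec j) := by
  have hstd : LinearIndependent ℝ (stdVec : Fin m → E m) := by
    rw [Fintype.linearIndependent_iff]
    intro g hg i
    have := congrArg (fun z : E m => z i) hg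
    simpa [stdVec_apply] using this
  have hw : LinearIndependent ℝ fun i => fderiv ℝ φ x (stdVec i) :=
    hstd.map' (fderiv ℝ φ x : E m →ₗ[ℝ] E m) (LinearMap.ker_eq_bot.2 (J.injective x hx))
  exact sum_gram_inv_smul (h (φ x)) _ hw B

/-- The mean curvature vector of a parametrized submanifold. -/
def meanCurvature (G : E n → E n →L[ℝ] E n →L[ℝ] ℝ) (F : E m → E n) (x : E m) : E n :=
  ∑ i, ∑ j, gramInv (pullback G F x) i j • secondForm G F x (stdVec i) (stdVec j)

variable (H : IsMetricOn G U) (K : IsImmersionOn ψ U' U) (I : IsImmersionOn F V' U')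
  (J : IsImmersionOn φ V V')
include H K I J

/-- The composition formula is used on both sides; the coordinate changes themselves have zero
second fundamental form. -/
theorem secondForm_coordChange {x : E m} (hx : x ∈ V) (u v : E m) :
    secondForm G (ψ ∘ F ∘ φ) x u v = fderiv ℝ ψ (F (φ x))
      (secondForm (pullback G ψ) F (φ x) (fderiv ℝ φ x u) (fderiv ℝ φ x v)) := by
  rw [H.secondForm_comp K (I.comp J) hx, H.secondForm_eq_zero K ((I.comp J).mapsTo hx),
    (H.pullback K).secondForm_comp I J hx,
    ((H.pullback K).pullback I).secondForm_eq_zero J hx]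
  simp

omit H in
theorem pullback_coordChange {x : E m} (hx : x ∈ V) :
    pullback G (ψ ∘ F ∘ φ) x = pullback (pullback (pullback G ψ) F) φ x := by
  rw [pullback_comp K (I.comp J) G hx, pullback_comp I J _ hx]

/-- The second fundamental form as a bilinear map. -/
theorem exists_secondForm_bilinear {x : E m} (hx : x ∈ V) :
    ∃ B : E m →ₗ[ℝ] E m →ₗ[ℝ] E n, ∀ u v,
      B u v = secondForm (pullback G ψ) F (φ x) u v := by
  have h := (H.pullback K).secondForm_eq_normalPart I (J.mapsTo hx)
  refine ⟨LinearMap.mk₂ ℝ (fun u v => secondForm (pullback G ψ) F (φ x) u v) ?_ ?_ ?_ ?_,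
    fun _ _ => rfl⟩ <;> intros <;> simp only [h, map_add, map_smul, add_apply, smul_apply] <;>
    module

theorem meanCurvature_coordChange {x : E m} (hx : x ∈ V) :
    meanCurvature G (ψ ∘ F ∘ φ) x
      = fderiv ℝ ψ (F (φ x)) (meanCurvature (pullback G ψ) F (φ x)) := by
  obtain ⟨B, hB⟩ := exists_secondForm_bilinear H K I J hx
  simp only [meanCurvature, secondForm_coordChange H K I J hx, pullback_coordChange K I J hx,
    ← hB]
  rw [← sum_gramInv_pullback _ J hx B]
  simp

theorem secondFormNormSq_coordChange {x : E m} (hx : x ∈ V) :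
    secondFormNormSq G (ψ ∘ F ∘ φ) x = secondFormNormSq (pullback G ψ) F (φ x) := by
  obtain ⟨B, hB⟩ := exists_secondForm_bilinear H K I J hx
  -- The fourfold sum becomes a trace over `(i, k)` of a trace over `(j, l)`, and basis independence
  -- is then applied to each trace in turn.
  have hswap : ∀ (b : Matrix (Fin m) (Fin m) ℝ) (q : E m → E m → E m → E m → ℝ) (w : Fin m → E m),
      ∑ i, ∑ j, ∑ k, ∑ l, b i k * b j l * q (w i) (w j) (w k) (w l)
        = ∑ i, ∑ k, b i k • ∑ j, ∑ l, b j l • q (w i) (w j) (w k) (w l) := by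
    intro b q w
    refine Finset.sum_congr rfl fun i _ => ?_
    rw [Finset.sum_comm]
    refine Finset.sum_congr rfl fun k _ => ?_
    simp only [smul_eq_mul, mul_assoc, Finset.mul_sum]
  have h0 : ∀ (p q : E n), G ((ψ ∘ F ∘ φ) x) (fderiv ℝ ψ (F (φ x)) p) (fderiv ℝ ψ (F (φ x)) q)
      = pullback G ψ (F (φ x)) p q := fun p q => rfl
  let g : E n →ₗ[ℝ] E n →ₗ[ℝ] ℝ := LinearMap.mk₂ ℝ (fun p q => pullback G ψ (F (φ x)) p q)
    (by intros; simp) (by intros; simp) (by intros; simp) (by intros; simp)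
  have hg : ∀ p q, pullback G ψ (F (φ x)) p q = g p q := fun _ _ => rfl
  have hL : secondFormNormSq G (ψ ∘ F ∘ φ) x = ∑ i, ∑ j, ∑ k, ∑ l,
      gramInv (pullback (pullback (pullback G ψ) F) φ x) i k
        * gramInv (pullback (pullback (pullback G ψ) F) φ x) j l
        * g (B (fderiv ℝ φ x (stdVec i)) (fderiv ℝ φ x (stdVec j)))
          (B (fderiv ℝ φ x (stdVec k)) (fderiv ℝ φ x (stdVec l))) := by
    simp only [secondFormNormSq, secondForm_coordChange H K I J hx,
      pullback_coordChange K I J hx, h0, hB, hg]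
  have hR : secondFormNormSq (pullback G ψ) F (φ x) = ∑ i, ∑ j, ∑ k, ∑ l,
      gramInv (pullback (pullback G ψ) F (φ x)) i k * gramInv (pullback (pullback G ψ) F (φ x)) j l
        * g (B (stdVec i) (stdVec j)) (B (stdVec k) (stdVec l)) := by
    simp only [secondFormNormSq, hB, hg]
  rw [hL, hR, hswap _ (fun p q r s => g (B p q) (B r s)) (fun i => fderiv ℝ φ x (stdVec i)),
    hswap _ (fun p q r s => g (B p q) (B r s)) stdVec]
  have h1 : ∀ p r, ∑ j, ∑ l, gramInv (pullback (pullback (pullback G ψ) F) φ x) j l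
      • g (B p (fderiv ℝ φ x (stdVec j))) (B r (fderiv ℝ φ x (stdVec l)))
      = ∑ j, ∑ l, gramInv (pullback (pullback G ψ) F (φ x)) j l
        • g (B p (stdVec j)) (B r (stdVec l)) := fun p r =>
    sum_gramInv_pullback _ J hx (g.compl₁₂ (B p) (B r))
  simp only [h1]
  have h2 := sum_gramInv_pullback (pullback (pullback G ψ) F) J hx
    (∑ j, ∑ l, gramInv (pullback (pullback G ψ) F (φ x)) j l
      • g.compl₁₂ (B.flip (stdVec j)) (B.flip (stdVec l)))
  simpa only [LinearMap.sum_apply, LinearMap.smul_apply, LinearMap.compl₁₂_apply,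
    LinearMap.flip_apply] using h2

end LocalGeometry

namespace ManifoldGeometry

open LocalGeometry

variable {m n : ℕ} {M S : Type*}
  [TopologicalSpace M] [ChartedSpace (EuclideanSpace ℝ (Fin n)) M]
  [TopologicalSpace S] [ChartedSpace (EuclideanSpace ℝ (Fin m)) S]

/-! ### Tensors on manifolds read in charts -/

theorem mdifferentiable_of_mem_maximalAtlas [IsManifold (𝓡 n) ∞ M]
    {e : OpenPartialHomeomorph M (EuclideanSpace ℝ (Fin n))}
    (he : e ∈ IsManifold.maximalAtlas (𝓡 n) ∞ M) : e.MDifferentiable (𝓡 n) (𝓡 n) :=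
  ⟨(contMDiffOn_of_mem_maximalAtlas he).mdifferentiableOn (by simp),
    (contMDiffOn_symm_of_mem_maximalAtlas he).mdifferentiableOn (by simp)⟩

theorem inChart_apply (g : ∀ p : M, TangentSpace (𝓡 n) p →L[ℝ] TangentSpace (𝓡 n) p →L[ℝ] ℝ)
    (e : OpenPartialHomeomorph M (EuclideanSpace ℝ (Fin n))) (y u v : E n) :
    inChart g e y u v = g (e.symm y) (mfderiv (𝓡 n) (𝓡 n) e.symm y u)
      (mfderiv (𝓡 n) (𝓡 n) e.symm y v) := rfl

theorem inducedMetric_apply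
    (g : ∀ p : M, TangentSpace (𝓡 n) p →L[ℝ] TangentSpace (𝓡 n) p →L[ℝ] ℝ)
    (f : S → M) (p : S) (u v : TangentSpace (𝓡 m) p) :
    inducedMetric g f p u v = g (f p) (mfderiv (𝓡 m) (𝓡 n) f p u) (mfderiv (𝓡 m) (𝓡 n) f p v) :=
  rfl

/-- `TangentSpace` at `p` is identified with the model space through the preferred chart at `p`, so
that chart has identity derivative there. -/
theorem mfderiv_chartAt_symm [IsManifold (𝓡 n) ∞ M] (p : M) :
    mfderiv (𝓡 n) (𝓡 n) (chartAt (EuclideanSpace ℝ (Fin n)) p).symm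
      (chartAt (EuclideanSpace ℝ (Fin n)) p p) = ContinuousLinearMap.id ℝ (E n) := by
  have : IsManifold (𝓡 n) 1 M := IsManifold.of_le (n := ∞) (by simp)
  have h := mfderivWithin_range_extChartAt_symm (I := 𝓡 n) (x := p)
  simp only [mfld_simps, mfderivWithin_univ] at h
  exact h

theorem inChart_chartAt [IsManifold (𝓡 n) ∞ M]
    (g : ∀ p : M, TangentSpace (𝓡 n) p →L[ℝ] TangentSpace (𝓡 n) p →L[ℝ] ℝ) (p : M) :
    inChart g (chartAt (EuclideanSpace ℝ (Fin n)) p) (chartAt (EuclideanSpace ℝ (Fin n)) p p)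
      = g p := by
  ext u v
  rw [inChart_apply, mfderiv_chartAt_symm]
  -- The fibre of `g` depends on the base point; fixing all types to `E n` allows rewriting along
  -- `e.symm (e p) = p`.
  have : ∀ q : M, q = p → (g q : E n →L[ℝ] E n →L[ℝ] ℝ) u v
      = (g p : E n →L[ℝ] E n →L[ℝ] ℝ) u v := by
    rintro _ rfl; rfl
  exact this _ ((chartAt (EuclideanSpace ℝ (Fin n)) p).left_inv (mem_chart_source _ p))

theorem contDiffAt_inChart [IsManifold (𝓡 n) ∞ M]
    (g : Bundle.ContMDiffRiemannianMetric (𝓡 n) ∞ (EuclideanSpace ℝ (Fin n))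
      (fun p : M => TangentSpace (𝓡 n) p))
    {e : OpenPartialHomeomorph M (EuclideanSpace ℝ (Fin n))}
    (he : e ∈ IsManifold.maximalAtlas (𝓡 n) ∞ M) {y : E n} (hy : y ∈ e.target) :
    ContDiffAt ℝ ∞ (inChart g.inner e) y := by
  have : IsManifold (𝓡 n) 1 M := IsManifold.of_le (n := ∞) (by simp)
  refine contDiffAt_clm_apply fun u => contDiffAt_clm_apply fun v => ?_
  simp only [inChart_apply]
  have hsymm := contMDiffAt_symm_of_mem_maximalAtlas he hy
  -- The tangent map of `e.symm` turns a constant field into a smooth lift to the tangent bundle, on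
  -- which the smooth bundle metric can be evaluated.
  have hsec : ∀ u : E n, ContMDiffAt (𝓡 n) (𝓡 n).tangent ∞
      (fun y => (⟨e.symm y, mfderiv (𝓡 n) (𝓡 n) e.symm y u⟩ : TangentBundle (𝓡 n) M)) y := by
    intro u
    have h1 := (contMDiffOn_symm_of_mem_maximalAtlas he).contMDiffOn_tangentMapWithin
      (m := ∞) (by simp) e.open_target.uniqueMDiffOn
    have h2 : ContMDiff (𝓡 n) (𝓡 n).tangent ∞
        (fun y : E n => (⟨y, u⟩ : TangentBundle (𝓡 n) (E n))) := by
      intro z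
      exact contMDiffAt_vectorSpace_iff_contDiffAt.2 contDiffAt_const
    have h3 : ContMDiffOn (𝓡 n) (𝓡 n).tangent ∞ (tangentMapWithin (𝓡 n) (𝓡 n) e.symm e.target ∘
        fun y : E n => (⟨y, u⟩ : TangentBundle (𝓡 n) (E n))) e.target :=
      h1.comp h2.contMDiffOn fun z hz => hz
    refine (h3.contMDiffAt (e.open_target.mem_nhds hy)).congr_of_eventuallyEq ?_
    filter_upwards [e.open_target.mem_nhds hy] with z hz
    simp only [Function.comp_apply, tangentMapWithin,
      mfderivWithin_of_isOpen e.open_target hz]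
  have hg : ContMDiffAt (𝓡 n) ((𝓡 n).prod 𝓘(ℝ, E n →L[ℝ] E n →L[ℝ] ℝ)) ∞
      (fun y => Bundle.TotalSpace.mk' (E n →L[ℝ] E n →L[ℝ] ℝ)
        (E := fun p : M => TangentSpace (𝓡 n) p →L[ℝ] TangentSpace (𝓡 n) p →L[ℝ] ℝ)
        (e.symm y) (g.inner (e.symm y))) y := (g.contMDiff (e.symm y)).comp y hsymm
  have := ContMDiffAt.clm_bundle_apply₂ (F₁ := E n) (F₂ := E n) (E₃ := Bundle.Trivial M ℝ)
    (F₃ := ℝ) hg (hsec u) (hsec v)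
  rw [Bundle.contMDiffAt_totalSpace] at this
  exact contMDiffAt_iff_contDiffAt.1 this.2

theorem isMetricOn_inChart [IsManifold (𝓡 n) ∞ M]
    (g : Bundle.ContMDiffRiemannianMetric (𝓡 n) ∞ (EuclideanSpace ℝ (Fin n))
      (fun p : M => TangentSpace (𝓡 n) p))
    {e : OpenPartialHomeomorph M (EuclideanSpace ℝ (Fin n))}
    (he : e ∈ IsManifold.maximalAtlas (𝓡 n) ∞ M) :
    IsMetricOn (inChart g.inner e) e.target where
  isOpen := e.open_target
  smooth _ hy := contDiffAt_inChart g he hy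
  inner _ hy :=
    { symm := fun _ _ => g.symm _ _ _
      pos := fun _ hv => g.pos _ _ fun h0 => hv <|
        (mdifferentiable_of_mem_maximalAtlas he).symm.mfderiv_injective hy
          (h0.trans (map_zero _).symm) }

/-- The domain of the coordinate representation `e' ∘ f ∘ e.symm`. -/
def repDomain (f : S → M) (e : OpenPartialHomeomorph S (EuclideanSpace ℝ (Fin m)))
    (e' : OpenPartialHomeomorph M (EuclideanSpace ℝ (Fin n))) : Set (E m) :=
  e.target ∩ (f ∘ e.symm) ⁻¹' e'.source

section representation

variable [IsManifold (𝓡 n) ∞ M] [IsManifold (𝓡 m) ∞ S] {f : S → M}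
  (hf : ContMDiff (𝓡 m) (𝓡 n) ∞ f)
  {e : OpenPartialHomeomorph S (EuclideanSpace ℝ (Fin m))}
  (he : e ∈ IsManifold.maximalAtlas (𝓡 m) ∞ S)
  {e' : OpenPartialHomeomorph M (EuclideanSpace ℝ (Fin n))}
  (he' : e' ∈ IsManifold.maximalAtlas (𝓡 n) ∞ M)
include hf

omit [IsManifold (𝓡 n) ∞ M] [IsManifold (𝓡 m) ∞ S] in
theorem isOpen_repDomain : IsOpen (repDomain f e e') :=
  (hf.continuous.comp_continuousOn e.continuousOn_symm).isOpen_inter_preimage e.open_target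
    e'.open_source

include he he'

omit [IsManifold (𝓡 n) ∞ M] [IsManifold (𝓡 m) ∞ S] in
theorem contDiffAt_rep {y : E m} (hy : y ∈ repDomain f e e') :
    ContDiffAt ℝ ∞ (e' ∘ f ∘ e.symm) y :=
  contMDiffAt_iff_contDiffAt.1 ((contMDiffAt_of_mem_maximalAtlas he' hy.2).comp y
    ((hf _).comp y (contMDiffAt_symm_of_mem_maximalAtlas he hy.1)))

/-- The chain rule on both sides of $e'^{-1}\circ(e'\circ f\circ e^{-1}) = f\circ e^{-1}$ near `y`.
-/
theorem mfderiv_rep {y : E m} (hy : y ∈ repDomain f e e') (u : E m) :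
    (mfderiv (𝓡 n) (𝓡 n) e'.symm (e' (f (e.symm y))) : E n →L[ℝ] E n)
      (fderiv ℝ (e' ∘ f ∘ e.symm) y u)
      = (mfderiv (𝓡 m) (𝓡 n) f (e.symm y) : E m →L[ℝ] E n)
        ((mfderiv (𝓡 m) (𝓡 m) e.symm y : E m →L[ℝ] E m) u) := by
  have h1 : MDifferentiableAt (𝓡 n) (𝓡 n) e'.symm (e' (f (e.symm y))) :=
    (mdifferentiable_of_mem_maximalAtlas he').mdifferentiableAt_symm (e'.map_source hy.2)
  have h2 : MDifferentiableAt (𝓡 m) (𝓡 n) (e' ∘ f ∘ e.symm) y :=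
    (contMDiffAt_iff_contDiffAt.2 (contDiffAt_rep hf he he' hy)).mdifferentiableAt (by simp)
  have h3 : MDifferentiableAt (𝓡 m) (𝓡 m) e.symm y :=
    (mdifferentiable_of_mem_maximalAtlas he).mdifferentiableAt_symm hy.1
  have h4 : MDifferentiableAt (𝓡 m) (𝓡 n) f (e.symm y) := (hf _).mdifferentiableAt (by simp)
  have heq : e'.symm ∘ (e' ∘ f ∘ e.symm) =ᶠ[nhds y] f ∘ e.symm := by
    filter_upwards [(isOpen_repDomain (e := e) (e' := e') hf).mem_nhds hy] with z hz
    exact e'.left_inv hz.2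
  have h5 := heq.mfderiv_eq (I := 𝓡 m) (I' := 𝓡 n)
  rw [mfderiv_comp y h4 h3] at h5
  have h6 : mfderiv (𝓡 m) (𝓡 n) (e'.symm ∘ (e' ∘ f ∘ e.symm)) y = _ := mfderiv_comp y h1 h2
  have h7 := DFunLike.congr_fun (h6.symm.trans h5) u
  rw [mfderiv_eq_fderiv] at h7
  exact h7

theorem inChart_inducedMetric
    (g : ∀ p : M, TangentSpace (𝓡 n) p →L[ℝ] TangentSpace (𝓡 n) p →L[ℝ] ℝ)
    {y : E m} (hy : y ∈ repDomain f e e') :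
    inChart (inducedMetric g f) e y = pullback (inChart g e') (e' ∘ f ∘ e.symm) y := by
  ext u v
  have hg : ∀ q q' : M, q = q' → ∀ a b : E n, (g q : E n →L[ℝ] E n →L[ℝ] ℝ) a b
      = (g q' : E n →L[ℝ] E n →L[ℝ] ℝ) a b := by
    rintro q _ rfl a b; rfl
  have h := hg _ _ (e'.left_inv hy.2).symm
    ((mfderiv (𝓡 m) (𝓡 n) f (e.symm y) : E m →L[ℝ] E n)
        ((mfderiv (𝓡 m) (𝓡 m) e.symm y : E m →L[ℝ] E m) u))
    ((mfderiv (𝓡 m) (𝓡 n) f (e.symm y) : E m →L[ℝ] E n)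
        ((mfderiv (𝓡 m) (𝓡 m) e.symm y : E m →L[ℝ] E m) v))
  refine Eq.trans h ?_
  rw [← mfderiv_rep hf he he' hy u, ← mfderiv_rep hf he he' hy v]
  rfl

theorem isImmersionOn_rep (hinj : ∀ p, Function.Injective (mfderiv (𝓡 m) (𝓡 n) f p)) :
    IsImmersionOn (e' ∘ f ∘ e.symm) (repDomain f e e') e'.target where
  isOpen := isOpen_repDomain hf
  smooth y hy := contDiffAt_rep hf he he' hy
  mapsTo y hy := e'.map_source hy.2
  injective y hy u v huv := by
    have hu := mfderiv_rep hf he he' hy u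
    rw [huv, mfderiv_rep hf he he' hy v] at hu
    exact (mdifferentiable_of_mem_maximalAtlas he).symm.mfderiv_injective hy.1 (hinj _ hu.symm)

end representation

end ManifoldGeometry

/-! ### Restriction of domains and dependence on germs. -/

namespace LocalGeometry

variable {m n : ℕ}

theorem IsImmersionOn.restrict {F : E m → E n} {V : Set (E m)} {U U' : Set (E n)}
    (I : IsImmersionOn F V U) (hU' : IsOpen U') : IsImmersionOn F (V ∩ F ⁻¹' U') U' where
  isOpen := ContinuousOn.isOpen_inter_preimage
    (fun y hy => (I.smooth y hy).continuousAt.continuousWithinAt) I.isOpen hU'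
  smooth y hy := I.smooth y hy.1
  mapsTo _ hy := hy.2
  injective y hy := I.injective y hy.1

theorem pullback_congr {G G' : E n → E n →L[ℝ] E n →L[ℝ] ℝ} {F F' : E m → E n} {x : E m}
    (h : G (F x) = G' (F x)) (hF : F =ᶠ[nhds x] F') : pullback G F x = pullback G' F' x := by
  rw [pullback, pullback, hF.fderiv_eq, h, hF.eq_of_nhds]

theorem secondFormNormSq_congr {G G' : E n → E n →L[ℝ] E n →L[ℝ] ℝ} {F F' : E m → E n} {x : E m}
    (h : G =ᶠ[nhds (F x)] G') (hF : F =ᶠ[nhds x] F') :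
    secondFormNormSq G F x = secondFormNormSq G' F' x := by
  have h' : G (F' x) = G' (F' x) := hF.eq_of_nhds ▸ h.eq_of_nhds
  simp only [secondFormNormSq, secondForm_congr h hF, pullback_congr h.eq_of_nhds hF, hF.eq_of_nhds,
    h']

theorem meanCurvature_congr {G G' : E n → E n →L[ℝ] E n →L[ℝ] ℝ} {F F' : E m → E n} {x : E m}
    (h : G =ᶠ[nhds (F x)] G') (hF : F =ᶠ[nhds x] F') :
    meanCurvature G F x = meanCurvature G' F' x := by
  simp only [meanCurvature, secondForm_congr h hF, pullback_congr h.eq_of_nhds hF]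

end LocalGeometry

/-! ### Comparison of the invariants in different charts. -/

namespace ManifoldGeometry

open LocalGeometry

section surface

variable {m n : ℕ} {M S : Type*}
  [TopologicalSpace M] [ChartedSpace (EuclideanSpace ℝ (Fin n)) M] [IsManifold (𝓡 n) ∞ M]
  [TopologicalSpace S] [ChartedSpace (EuclideanSpace ℝ (Fin m)) S] [IsManifold (𝓡 m) ∞ S]

-- A transition map is the coordinate representation of `id`, so with this lemma
-- `inChart_inducedMetric` becomes the transformation law of the metric.
omit [IsManifold (𝓡 n) ∞ M] in
theorem inducedMetric_id
    (g : ∀ p : M, TangentSpace (𝓡 n) p →L[ℝ] TangentSpace (𝓡 n) p →L[ℝ] ℝ) :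
    inducedMetric g (id : M → M) = g := by
  ext p u v
  rw [inducedMetric_apply, mfderiv_id]
  rfl

theorem pullback_eq_inducedMetric
    (g : ∀ p : M, TangentSpace (𝓡 n) p →L[ℝ] TangentSpace (𝓡 n) p →L[ℝ] ℝ) {f : S → M}
    (hf : ContMDiff (𝓡 m) (𝓡 n) ∞ f) (q : S) :
    pullback (inChart g (chartAt (EuclideanSpace ℝ (Fin n)) (f q)))
      (chartAt (EuclideanSpace ℝ (Fin n)) (f q) ∘ f ∘ (chartAt (EuclideanSpace ℝ (Fin m)) q).symm)
      (chartAt (EuclideanSpace ℝ (Fin m)) q q) = inducedMetric (m := m) (n := n) g f q := by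
  rw [← inChart_inducedMetric hf (IsManifold.chart_mem_maximalAtlas q)
    (IsManifold.chart_mem_maximalAtlas (f q)), inChart_chartAt]
  exact ⟨mem_chart_target _ q, by simp⟩

omit [IsManifold (𝓡 m) ∞ S] in
theorem inChart_rep
    (g : ∀ p : M, TangentSpace (𝓡 n) p →L[ℝ] TangentSpace (𝓡 n) p →L[ℝ] ℝ) (f : S → M) (q : S) :
    inChart g (chartAt (EuclideanSpace ℝ (Fin n)) (f q))
      ((chartAt (EuclideanSpace ℝ (Fin n)) (f q) ∘ f ∘
        (chartAt (EuclideanSpace ℝ (Fin m)) q).symm) (chartAt (EuclideanSpace ℝ (Fin m)) q q))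
      = g (f q) := by
  rw [← inChart_chartAt g (f q)]
  simp

theorem secondFundamentalFormNormSq_eq
    (g : ∀ p : M, TangentSpace (𝓡 n) p →L[ℝ] TangentSpace (𝓡 n) p →L[ℝ] ℝ) {f : S → M}
    (hf : ContMDiff (𝓡 m) (𝓡 n) ∞ f) (q : S) :
    secondFundamentalFormNormSq (m := m) g f q
      = secondFormNormSq (inChart g (chartAt (EuclideanSpace ℝ (Fin n)) (f q)))
      (chartAt (EuclideanSpace ℝ (Fin n)) (f q) ∘ f ∘ (chartAt (EuclideanSpace ℝ (Fin m)) q).symm)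
      (chartAt (EuclideanSpace ℝ (Fin m)) q q) := by
  rw [secondFormNormSq, pullback_eq_inducedMetric g hf, inChart_rep]
  rfl

theorem meanCurvatureVector_eq
    (g : ∀ p : M, TangentSpace (𝓡 n) p →L[ℝ] TangentSpace (𝓡 n) p →L[ℝ] ℝ) {f : S → M}
    (hf : ContMDiff (𝓡 m) (𝓡 n) ∞ f) (q : S) :
    meanCurvatureVector (m := m) g f q
      = meanCurvature (inChart g (chartAt (EuclideanSpace ℝ (Fin n)) (f q)))
      (chartAt (EuclideanSpace ℝ (Fin n)) (f q) ∘ f ∘ (chartAt (EuclideanSpace ℝ (Fin m)) q).symm)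
      (chartAt (EuclideanSpace ℝ (Fin m)) q q) := by
  rw [meanCurvature, pullback_eq_inducedMetric g hf]
  rfl

variable (g : Bundle.ContMDiffRiemannianMetric (𝓡 n) ∞ (EuclideanSpace ℝ (Fin n))
      (fun p : M => TangentSpace (𝓡 n) p)) {f : S → M}
  (hf : ContMDiff (𝓡 m) (𝓡 n) ∞ f) (hinj : ∀ p, Function.Injective (mfderiv (𝓡 m) (𝓡 n) f p))
  {e c : OpenPartialHomeomorph S (EuclideanSpace ℝ (Fin m))}
  (he : e ∈ IsManifold.maximalAtlas (𝓡 m) ∞ S) (hc : c ∈ IsManifold.maximalAtlas (𝓡 m) ∞ S)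
  {e' c' : OpenPartialHomeomorph M (EuclideanSpace ℝ (Fin n))}
  (he' : e' ∈ IsManifold.maximalAtlas (𝓡 n) ∞ M) (hc' : c' ∈ IsManifold.maximalAtlas (𝓡 n) ∞ M)
include hf hinj he hc he' hc'

/-- The norm of the second fundamental form and the vanishing of the mean curvature do not depend
on the charts. -/
theorem chart_independence {q : S} (hqe : q ∈ e.source) (hqc : q ∈ c.source)
    (hqe' : f q ∈ e'.source) (hqc' : f q ∈ c'.source) :
    secondFormNormSq (inChart g.inner c') (c' ∘ f ∘ c.symm) (c q)
      = secondFormNormSq (inChart g.inner e') (e' ∘ f ∘ e.symm) (e q) ∧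
    (meanCurvature (inChart g.inner c') (c' ∘ f ∘ c.symm) (c q) = 0 →
      meanCurvature (inChart g.inner e') (e' ∘ f ∘ e.symm) (e q) = 0) := by
  have idinj : ∀ p : M, Function.Injective (mfderiv (𝓡 n) (𝓡 n) (id : M → M) p) := fun p => by
    rw [mfderiv_id]; exact Function.injective_id
  have idinj' : ∀ p : S, Function.Injective (mfderiv (𝓡 m) (𝓡 m) (id : S → S) p) := fun p => by
    rw [mfderiv_id]; exact Function.injective_id
  have H := isMetricOn_inChart g hc'
  -- `K` and `J` are the transition maps of the target and of the surface; the domains are cut down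
  -- so that all three maps compose.
  have K := isImmersionOn_rep (contMDiff_id (I := 𝓡 n)) he' hc' idinj
  have I := (isImmersionOn_rep hf he he' hinj).restrict K.isOpen
  have J := (isImmersionOn_rep (contMDiff_id (I := 𝓡 m)) hc he idinj').restrict I.isOpen
  have hce : e (c.symm (c q)) = e q := by rw [c.left_inv hqc]
  have hyV : e q ∈ repDomain f e e' := ⟨e.map_source hqe, by simpa [e.left_inv hqe] using hqe'⟩
  have hFU : (e' ∘ f ∘ e.symm) (e q) ∈ repDomain (id : M → M) e' c' := by
    simp only [Function.comp_apply, e.left_inv hqe]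
    exact ⟨e'.map_source hqe', by simpa [e'.left_inv hqe'] using hqc'⟩
  have hx : c q ∈ repDomain (id : S → S) c e ∩ (e ∘ id ∘ c.symm) ⁻¹' (repDomain f e e' ∩
      (e' ∘ f ∘ e.symm) ⁻¹' repDomain (id : M → M) e' c') := by
    refine ⟨⟨c.map_source hqc, by simpa [c.left_inv hqc] using hqe⟩, ?_⟩
    simp only [Set.mem_preimage, Function.comp_apply, id, hce]
    exact ⟨hyV, hFU⟩
  have hF : (c' ∘ id ∘ e'.symm) ∘ (e' ∘ f ∘ e.symm) ∘ (e ∘ id ∘ c.symm)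
      =ᶠ[nhds (c q)] c' ∘ f ∘ c.symm := by
    filter_upwards [J.isOpen.mem_nhds hx] with z hz
    have h1 : c.symm z ∈ e.source := hz.1.2
    have h2 : f (e.symm (e (c.symm z))) ∈ e'.source := hz.2.1.2
    rw [e.left_inv h1] at h2
    simp [e.left_inv h1, e'.left_inv h2]
  have hG : pullback (inChart g.inner c') (c' ∘ id ∘ e'.symm)
      =ᶠ[nhds ((e' ∘ f ∘ e.symm) (e q))] inChart g.inner e' := by
    filter_upwards [K.isOpen.mem_nhds hFU] with z hz
    rw [← inChart_inducedMetric (contMDiff_id (I := 𝓡 n)) he' hc' _ hz, inducedMetric_id]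
  have hφ : (e ∘ id ∘ c.symm) (c q) = e q := hce
  constructor
  · rw [← secondFormNormSq_congr (Filter.EventuallyEq.refl _ _) hF,
      secondFormNormSq_coordChange H K I J hx, hφ,
      secondFormNormSq_congr hG (Filter.EventuallyEq.refl _ _)]
  · intro h0
    rw [← meanCurvature_congr (Filter.EventuallyEq.refl _ _) hF,
      meanCurvature_coordChange H K I J hx, hφ,
      meanCurvature_congr hG (Filter.EventuallyEq.refl _ _)] at h0
    -- The mean curvature vectors correspond under the injective differential of the transition map,
    -- so one vanishes if the other does.
    exact K.injective _ hFU (h0.trans (map_zero _).symm)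

end surface

end ManifoldGeometry

end

/-! ### The theorem, in the preferred charts at `p` and `f p`. -/

open ManifoldGeometry LocalGeometry

theorem theorem2p2
    {M : Type*} [TopologicalSpace M] [ChartedSpace (EuclideanSpace ℝ (Fin 3)) M]
    [IsManifold (𝓡 3) ∞ M]
    (g : Bundle.ContMDiffRiemannianMetric (𝓡 3) ∞ (EuclideanSpace ℝ (Fin 3))
      (fun p : M => TangentSpace (𝓡 3) p))
    (hyperbolic : ManifoldGeometry.HasConstantSectionalCurvature g.inner (-1))
    {S : Type*} [TopologicalSpace S] [ChartedSpace (EuclideanSpace ℝ (Fin 2)) S]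
    [IsManifold (𝓡 2) ∞ S]
    (f : S → M) (hf : ManifoldGeometry.IsMinimalImmersion (m := 2) g.inner f)
    (p : S) (hp : ManifoldGeometry.secondFundamentalFormNormSq (m := 2) g.inner f p ≠ 0) :
    ContMDiffAt (𝓡 2) 𝓘(ℝ, ℝ) ∞
      (fun q => Real.log (ManifoldGeometry.secondFundamentalFormNormSq (m := 2) g.inner f q)) p ∧
    ManifoldGeometry.laplacian (ManifoldGeometry.inducedMetric (m := 2) g.inner f)
        (fun q => Real.log (ManifoldGeometry.secondFundamentalFormNormSq (m := 2) g.inner f q)) p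
      = 4 * ManifoldGeometry.gaussCurvature
          (ManifoldGeometry.inducedMetric (m := 2) g.inner f) p ∧
    4 * ManifoldGeometry.gaussCurvature
          (ManifoldGeometry.inducedMetric (m := 2) g.inner f) p
      = -2 * (2 + ManifoldGeometry.secondFundamentalFormNormSq (m := 2) g.inner f p) := by
  set e := chartAt (EuclideanSpace ℝ (Fin 2)) p with he_def
  set e' := chartAt (EuclideanSpace ℝ (Fin 3)) (f p) with he'_def
  have he : e ∈ IsManifold.maximalAtlas (𝓡 2) ∞ S := IsManifold.chart_mem_maximalAtlas p
  have he' : e' ∈ IsManifold.maximalAtlas (𝓡 3) ∞ M := IsManifold.chart_mem_maximalAtlas (f p)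
  set F := e' ∘ f ∘ e.symm with hF_def
  have I := isImmersionOn_rep hf.smooth he he' hf.immersion
  have H := isMetricOn_inChart g he'
  have hx : e p ∈ repDomain f e e' := ⟨mem_chart_target _ p, by simp [he_def, he'_def]⟩
  -- At a nearby point the definitions use the preferred charts of that point; chart independence
  -- transfers both statements to the fixed charts `e` and `e'`.
  have hval : ∀ y ∈ repDomain f e e',
      secondFundamentalFormNormSq (m := 2) g.inner f (e.symm y)
        = secondFormNormSq (inChart g.inner e') F y ∧
      meanCurvature (inChart g.inner e') F y = 0 := by
    intro y hy
    obtain ⟨h1, h2⟩ := chart_independence g hf.smooth hf.immersion he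
      (IsManifold.chart_mem_maximalAtlas (e.symm y)) he'
      (IsManifold.chart_mem_maximalAtlas (f (e.symm y))) (e.map_target hy.1)
      (mem_chart_source _ _) hy.2 (mem_chart_source _ _)
    rw [← secondFundamentalFormNormSq_eq g.inner hf.smooth, e.right_inv hy.1] at h1
    rw [← meanCurvatureVector_eq g.inner hf.smooth, e.right_inv hy.1] at h2
    exact ⟨h1, h2 (hf.minimal _)⟩
  have hpx := (hval _ hx).1
  rw [show e.symm (e p) = p from e.left_inv (mem_chart_source _ p)] at hpx
  have hnhds := I.isOpen.mem_nhds hx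
  obtain ⟨h1, h2, h3⟩ := laplace_log_secondFormNormSq H I (fun y hy => hyperbolic e' he' y hy)
    (fun y hy => (hval y hy).2) hx (hpx ▸ hp)
  have hmet : inChart (inducedMetric g.inner f) e
      =ᶠ[nhds (e p)] pullback (inChart g.inner e') F := by
    filter_upwards [hnhds] with y hy using inChart_inducedMetric hf.smooth he he' g.inner hy
  have hK : gaussCurvature (inducedMetric g.inner f) p
      = sectional (pullback (inChart g.inner e') F) (e p) (stdVec 0) (stdVec 1) :=
    sectional_congr hmet _ _
  refine ⟨?_, ?_, ?_⟩
  · refine (h1.contMDiffAt.comp p (contMDiffAt_of_mem_maximalAtlas he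
      (mem_chart_source _ p))).congr_of_eventuallyEq ?_
    have hc := (contMDiffAt_of_mem_maximalAtlas (n := ∞) he (mem_chart_source _ p)).continuousAt
    filter_upwards [hc.preimage_mem_nhds hnhds, e.open_source.mem_nhds (mem_chart_source _ p)]
      with q hq hqs
    have := (hval _ hq).1
    rw [e.left_inv hqs] at this
    exact congrArg Real.log this
  · rw [hK, ← h2]
    refine laplace_congr hmet ?_
    filter_upwards [hnhds] with y hy
    exact congrArg Real.log (hval y hy).1
  · rw [hK, h3, hpx]
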